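/- **Definitions.** A consumption MDP (CMDP) $\mathcal M=(S,A,\Delta,C,R,cap)$ consists of a finite set $S$ of states, a finite nonempty set $A$ of actions, a total transition function $\Delta$ assigning to each $(s,a)\in S\times A$ a probability distribution on $S$, a consumption function $C:S\times A\to\mathbb N$, a set $R\subseteq S$ of reload states and a capacity $cap\in\mathbb N$. Put $Succ(s,a)=\{t\mid\Delta(s,a)(t)>0\}$, and let $\mathcal M(R')$ be $\mathcal M$ with $R$ replaced by $R'$. $\mathcal M$ is *decreasing* if every simple cycle of positive length contains a step $(s,a)$ with $C(s,a)>0$. A strategy $\sigma$ maps histories $s_1a_1\dots s_n$ to actions; it induces the set of $\sigma$-compatible runs from $s$ and the probability measure $\mathbb P^\sigma_s$ on runs. For an initial load $d\in\{0,\dots,cap\}$, the resource level along a history starts at $d$; a step $(s,a)$ changes level $m\ne\bot$ to $m-C(s,a)$ if $s\notin R$ and $C(s,a)\le m$, to $cap-C(s,a)$ if $s\in R$ and $C(s,a)\le cap$, and to $\bot$ otherwise; $\bot$ stays $\bot$. $\sigma$ is *$d$-safe in $s$* if the level is never $\bot$ on any $\sigma$-compatible run from $s$; it is *$T$-positive*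 (resp. *$T$-Büchi*) *$d$-safe in $s$* if moreover $T$ is visited with positive probability (resp. infinitely often with probability $1$). $Safe_{\mathcal M}(s)$, $SafePR_{\mathcal M,T}(s)$, $SafeB\ddot uchi_{\mathcal M,T}(s)\in\mathbb N\cup\{\infty\}$ are the least $d\in\{0,\dots,cap\}$ for which a $d$-safe, $T$-positive $d$-safe, $T$-Büchi $d$-safe strategy in $s$ exists, and $\infty$ if there is none. *Counter strategies.* A counter selector $\Sigma$ assigns to each state a partial function $\Sigma(s)$ from $\{0,\dots,cap\}$ to $A$. For a vector $\vec r\in(\mathbb N\cup\{\infty\})^S$ and a fixed default action $a_0$, the finite counter strategy $\Sigma^{\vec r}$ keeps a counter that starts at $\vec r(s_1)$ in the first state $s_1$ (at $\bot$ if $\vec r(s_1)>cap$) and is updated like the resource level; in state $s$ with counter $m$ it plays $\Sigma(s)(n)$ for the largest $n\le m$ in the domain of $\Sigma(s)$, and $a_0$ if there is none. *Algorithm 3* (input $\mathcal M,T$). An action $a$ is safe in $s$ if $Safe(s)=\infty$, or $s\notin R$ and $C(s,a)+\max_{t\in Succ(s,a)}Safe(t)\le Safe(s)$, or $s\in R$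 and $C(s,a)+\max_{t\in Succ(s,a)}Safe(t)\le cap$. Let $$SPR(s,a,\vec x)=C(s,a)+\min_{t\in Succ(s,a)}\max\bigl(\{\vec x(t)\}\cup\{Safe(t')\mid t'\in Succ(s,a),\,t'\ne t\}\bigr).$$ Start with $\vec r(s)=Safe(s)$ for $s\in T$, $\vec r(s)=\infty$ for $s\notin T$, and $\Sigma(s)(Safe(s))$ an arbitrary action safe in $s$ whenever $Safe(s)<\infty$ ($\Sigma$ is undefined elsewhere). In each iteration put $\vec r_{old}=\vec r$, choose for each $s\notin T$ an arbitrary minimizer $\vec a(s)$ of $SPR(s,\cdot,\vec r_{old})$ and set $\vec r(s)$ to the minimum; then replace each component of $\vec r$ that exceeds $cap$ by $\infty$ and each other component at a state of $R$ by $0$; then for each $s\notin T$ with $\vec r(s)<\vec r_{old}(s)$ set $\Sigma(s)(\vec r(s))=\vec a(s)$. Stop when $\vec r=\vec r_{old}$ and return $(\vec r,\Sigma)$. *Algorithm 4* (input $\mathcal M,T$). Start with $Rel=R$; repeatedly remove from $Rel$ all $q\in Rel$ with $SafePR_{\mathcal M(Rel),T}(q)>cap$; stop when there are none. **Theorem.**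 Let $\mathcal M$ be a decreasing CMDP and $T\subseteq S$. Algorithm 4 terminates on $\mathcal M,T$; let $R'$ be the contents of $Rel$ upon termination. Algorithm 3 can be run to termination on the input $\mathcal M(R'),T$, and for every pair $(\vec r,\Sigma)$ that it may return (for any resolution of its arbitrary choices) and every default action: 1. for every state $s$ with $\vec r(s)<\infty$ we have $\vec r(s)\le cap$, and the finite counter strategy $\Sigma^{\vec r}$ of $\mathcal M(R')$ is $T$-Büchi $\vec r(s)$-safe in $s$, both in $\mathcal M(R')$ and in $\mathcal M$; 2. $\vec r=SafeB\ddot uchi_{\mathcal M,T}$. -/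

import Mathlib

open scoped ENNReal

noncomputable section

namespace ConsumptionMDP

/-- A consumption Markov decision model with states `S` and actions `A` (finiteness of `S` and `A`
is assumed where it is used). -/
structure CMDP (S A : Type*) where
  /-- the total transition function -/
  trans : S → A → PMF S
  /-- the total consumption function -/
  cost : S → A → ℕ
  /-- the set of reload states -/
  reload : Set S
  /-- the resource capacity -/
  cap : ℕ

variable {S A : Type*}

/-- `M(R')`: the same CMDP with the set of reload states changed to `R'`. -/
def CMDP.withReload (M : CMDP S A) (R' : Set S) : CMDP S A :=
  { M with reload := R' }

/-- `Succ(s, a)`: the states reached from `s` under `a` with positive probability. -/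
def CMDP.succ (M : CMDP S A) (s : S) (a : A) : Set S := {t | 0 < M.trans s a t}

/-- Decreasing CMDPs: every simple cycle `p 0, a 0, p 1, …, a (n - 1), p n = p 0` of positive
length `n` (no state repeated apart from the endpoint) contains an action that consumes a positive
amount of the resource. -/
def CMDP.IsDecreasing (M : CMDP S A) : Prop :=
  ∀ (n : ℕ) (p : ℕ → S) (a : ℕ → A), 0 < n →
    (∀ i < n, p (i + 1) ∈ M.succ (p i) (a i)) →
    p n = p 0 → Set.InjOn p (Set.Iio n) →
    ∃ i < n, 0 < M.cost (p i) (a i)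

/-! ### Histories, strategies, runs -/

/-- Finite alternating sequences `s₁ a₁ s₂ … aₙ₋₁ sₙ`. -/
inductive History (S A : Type*) where
  | single (s : S) : History S A
  | snoc (β : History S A) (a : A) (t : S) : History S A

/-- The first state of a history. -/
def History.first : History S A → S
  | .single s => s
  | .snoc β _ _ => β.first

/-- The last state of a history. -/
def History.last : History S A → S
  | .single s => s
  | .snoc _ _ t => t

/-- A (deterministic, history-dependent) strategy. Its values on sequences that are not paths of
the CMDP play no role. -/
abbrev Strategy (S A : Type*) := History S A → A

/-- One position of a run: a state together with the action played there. -/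
def Step (S A : Type*) : Type _ := S × A

/-- The state of a step. -/
def Step.state (x : Step S A) : S := Prod.fst x

/-- The action of a step. -/
def Step.act (x : Step S A) : A := Prod.snd x

instance : MeasurableSpace (Step S A) := ⊤

instance : DiscreteMeasurableSpace (Step S A) := ⟨fun _ => trivial⟩

instance [Finite S] [Finite A] : Finite (Step S A) := inferInstanceAs (Finite (S × A))

/-- Infinite state-action sequences `s₁ a₁ s₂ a₂ …` (indexed from `0`), with the product
σ-algebra, which is generated by the cylinder sets. -/
abbrev Run (S A : Type*) := ℕ → Step S A

/-- The finite prefix of a run with `n` actions. -/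
def Run.pref (ρ : Run S A) : ℕ → History S A
  | 0 => .single (ρ 0).state
  | n + 1 => .snoc (Run.pref ρ n) (ρ n).act (ρ (n + 1)).state

/-- `Comp(σ, s)`: the `σ`-compatible `s`-initiated runs. -/
def CMDP.compatible (M : CMDP S A) (σ : Strategy S A) (s : S) : Set (Run S A) :=
  {ρ | (ρ 0).state = s ∧ ∀ i, (ρ i).act = σ (Run.pref ρ i) ∧
    (ρ (i + 1)).state ∈ M.succ (ρ i).state (ρ i).act}

/-- The history formed by the first `n + 1` states of a run that is known up to position `n`. -/
def prefHistory (n : ℕ) (x : (i : Finset.Iic n) → Step S A) : History S A :=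
  Run.pref (fun i => x ⟨min i n, Finset.mem_Iic.2 (min_le_right i n)⟩) n

/-- The law of the position `n + 1` given the positions `0, …, n`: the next state `t` is drawn from
`Δ(sₙ, aₙ)` and the next action is the one chosen by `σ` on the extended history. -/
def CMDP.stepPMF (M : CMDP S A) (σ : Strategy S A) (n : ℕ)
    (x : (i : Finset.Iic n) → Step S A) : PMF (Step S A) :=
  let last : Step S A := x ⟨n, Finset.mem_Iic.2 le_rfl⟩
  (M.trans last.state last.act).map
    (fun t => ((t, σ (.snoc (prefHistory n x) last.act t)) : S × A))

/-- `CMDP.stepPMF` as a Markov kernel. -/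
def CMDP.stepKernel [Finite S] [Finite A] (M : CMDP S A) (σ : Strategy S A) (n : ℕ) :
    ProbabilityTheory.Kernel ((i : Finset.Iic n) → Step S A) (Step S A) :=
  ProbabilityTheory.Kernel.ofFunOfCountable fun x => (M.stepPMF σ n x).toMeasure

instance [Finite S] [Finite A] (M : CMDP S A) (σ : Strategy S A) (n : ℕ) :
    ProbabilityTheory.IsMarkovKernel (M.stepKernel σ n) :=
  ⟨fun x => by
    change MeasureTheory.IsProbabilityMeasure (M.stepPMF σ n x).toMeasure
    infer_instance⟩

/-- The probability measure on runs induced by the strategy `σ` from the initial state `s`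
(Ionescu-Tulcea construction). -/
def CMDP.prob [Finite S] [Finite A] (M : CMDP S A) (σ : Strategy S A) (s : S) :
    MeasureTheory.Measure (Run S A) :=
  ProbabilityTheory.Kernel.traj (X := fun _ => Step S A) (M.stepKernel σ) 0
    (fun _ => ((s, σ (.single s)) : S × A))

/-! ### Resource levels and objectives -/

/-- The resource level after playing `a` in `s` with current level `m`; `⊥` is exhaustion. -/
def CMDP.updateLevel (M : CMDP S A) (m : WithBot ℕ) (s : S) (a : A) : WithBot ℕ :=
  open Classical in
  match m with
  | ⊥ => ⊥
  | (n : ℕ) =>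
    if s ∈ M.reload then
      if M.cost s a ≤ M.cap then ((M.cap - M.cost s a : ℕ) : WithBot ℕ) else ⊥
    else
      if M.cost s a ≤ n then ((n - M.cost s a : ℕ) : WithBot ℕ) else ⊥

/-- The resource level after a history, when the level before it is `m`. -/
def CMDP.level (M : CMDP S A) (m : WithBot ℕ) : History S A → WithBot ℕ
  | .single _ => m
  | .snoc β a _ => M.updateLevel (M.level m β) β.last a

/-- The runs on which the resource with initial load `d` is never exhausted. -/
def CMDP.safeRuns (M : CMDP S A) (d : ℕ) : Set (Run S A) :=
  {ρ | ∀ i, M.level d (Run.pref ρ i) ≠ ⊥}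

/-- The sequences that visit `T`. -/
def reachRuns (T : Set S) : Set (Run S A) := {ρ | ∃ i, (ρ i).state ∈ T}

/-- The sequences that visit `T` infinitely often. -/
def buchiRuns (T : Set S) : Set (Run S A) := {ρ | {i | (ρ i).state ∈ T}.Infinite}

/-- `σ` is `d`-safe in `s`. -/
def CMDP.IsSafe (M : CMDP S A) (σ : Strategy S A) (d : ℕ) (s : S) : Prop :=
  M.compatible σ s ⊆ M.safeRuns d

/-- `σ` is `T`-positive `d`-safe in `s`. -/
def CMDP.IsPosSafe [Finite S] [Finite A] (M : CMDP S A) (T : Set S) (σ : Strategy S A)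
    (d : ℕ) (s : S) : Prop :=
  M.IsSafe σ d s ∧ 0 < M.prob σ s (reachRuns T)

/-- `σ` is `T`-Büchi `d`-safe in `s`. -/
def CMDP.IsBuchiSafe [Finite S] [Finite A] (M : CMDP S A) (T : Set S) (σ : Strategy S A)
    (d : ℕ) (s : S) : Prop :=
  M.IsSafe σ d s ∧ M.prob σ s (buchiRuns T) = 1

/-- The least initial load `d ∈ {0, …, cap}` for which some strategy satisfies `P`, and `∞` if
there is none. -/
def CMDP.minLoad (M : CMDP S A) (P : Strategy S A → ℕ → Prop) : ℕ∞ :=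
  sInf {x : ℕ∞ | ∃ d : ℕ, d ≤ M.cap ∧ (∃ σ, P σ d) ∧ x = d}

/-- The vector `Safe`. -/
def CMDP.safe (M : CMDP S A) (s : S) : ℕ∞ := M.minLoad fun σ d => M.IsSafe σ d s

/-- The vector `SafePR` of safe positive reachability. -/
def CMDP.safePosReach [Finite S] [Finite A] (M : CMDP S A) (T : Set S) (s : S) : ℕ∞ :=
  M.minLoad fun σ d => M.IsPosSafe T σ d s

/-- The vector `SafeBüchi`. -/
def CMDP.safeBuchi [Finite S] [Finite A] (M : CMDP S A) (T : Set S) (s : S) : ℕ∞ :=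
  M.minLoad fun σ d => M.IsBuchiSafe T σ d s

/-! ### Counter selectors and finite counter strategies -/

/-- A selection rule: a partial function from `{0, …, cap}` to actions. -/
abbrev SelectionRule (A : Type*) (cap : ℕ) := Fin (cap + 1) → Option A

/-- A counter selector: a selection rule for every state. -/
abbrev CounterSelector (S A : Type*) (cap : ℕ) := S → SelectionRule A cap

/-- The action selected by a rule at level `m`: the value of the rule at the largest element of its
domain that is at most `m`, and the default action `a₀` if there is no such element. -/
def SelectionRule.select {cap : ℕ} (φ : SelectionRule A cap) (a₀ : A) (m : WithBot ℕ) : A :=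
  open Classical in
  let D : Finset (Fin (cap + 1)) :=
    Finset.univ.filter fun n => φ n ≠ none ∧ ((n : ℕ) : WithBot ℕ) ≤ m
  if h : D.Nonempty then (φ (D.max' h)).getD a₀ else a₀

/-- The initial counter value for the component `x` of a vector of initial loads: `x` itself
if `x ∈ {0, …, cap}`, and `⊥` otherwise. -/
def initialCounter (cap : ℕ) (x : ℕ∞) : WithBot ℕ :=
  open Classical in
  if x ≤ cap then ((x.toNat : ℕ) : WithBot ℕ) else ⊥

/-- The finite counter strategy of `M` given by the counter selector `Sel`, the vector `r` and the
default action `a₀`. Its memory is the counter, with values in `{⊥, 0, …, cap}`; the counter is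
initialized by `r` and updated along the history by `CMDP.updateLevel`. -/
def CMDP.counterStrategy (M : CMDP S A) (Sel : CounterSelector S A M.cap) (r : S → ℕ∞)
    (a₀ : A) : Strategy S A :=
  fun h => (Sel h.last).select a₀ (M.level (initialCounter M.cap (r h.first)) h)

/-! ### The algorithm for safe positive reachability -/

/-- Action `a` is safe in state `s`. -/
def CMDP.IsSafeAction (M : CMDP S A) (s : S) (a : A) : Prop :=
  M.safe s = ⊤ ∨
  (s ∉ M.reload ∧ (M.cost s a : ℕ∞) + (⨆ t ∈ M.succ s a, M.safe t) ≤ M.safe s) ∨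
  (s ∈ M.reload ∧ (M.cost s a : ℕ∞) + (⨆ t ∈ M.succ s a, M.safe t) ≤ M.cap)

/-- `SPR(s, a, x)`. -/
def CMDP.spr (M : CMDP S A) (s : S) (a : A) (x : S → ℕ∞) : ℕ∞ :=
  M.cost s a + ⨅ t ∈ M.succ s a, max (x t) (⨆ t' ∈ M.succ s a \ {t}, M.safe t')

/-- The two-sided truncation of a vector. -/
def CMDP.trunc (M : CMDP S A) (x : S → ℕ∞) (s : S) : ℕ∞ :=
  open Classical in
  if M.cap < x s then ⊤ else if s ∈ M.reload then 0 else x s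

/-- The vector at the start of the repeat-loop: `Safe` on `T` and `∞` elsewhere. -/
def CMDP.startVector (M : CMDP S A) (T : Set S) (s : S) : ℕ∞ :=
  open Classical in
  if s ∈ T then M.safe s else ⊤

/-- The selector at the start of the repeat-loop: in each state `s` with `Safe(s) < ∞` the only
rule is to play the action `α s` from level `Safe(s)` on. -/
def CMDP.startSelector (M : CMDP S A) (α : S → A) : CounterSelector S A M.cap :=
  open Classical in
  fun s n => if ((n : ℕ) : ℕ∞) = M.safe s then some (α s) else none

/-- The vector after one iteration of the repeat-loop started with the vector `r`. -/
def CMDP.nextVector (M : CMDP S A) (T : Set S) (r : S → ℕ∞) : S → ℕ∞ :=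
  open Classical in
  M.trunc fun s => if s ∈ T then r s else ⨅ a, M.spr s a r

/-- The selector after one iteration of the repeat-loop that changes the vector from `r` to `r'`,
where `α` gives the minimizing actions chosen in this iteration. -/
def CMDP.nextSelector (M : CMDP S A) (T : Set S) (r r' : S → ℕ∞) (α : S → A)
    (Sel : CounterSelector S A M.cap) : CounterSelector S A M.cap :=
  open Classical in
  fun s n => if s ∉ T ∧ r' s < r s ∧ ((n : ℕ) : ℕ∞) = r' s then some (α s) else Sel s n

/-- `α` is a possible choice of minimizing actions for the vector `r`. -/
def CMDP.IsArgmin (M : CMDP S A) (T : Set S) (r : S → ℕ∞) (α : S → A) : Prop :=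
  ∀ s, s ∉ T → ∀ b, M.spr s (α s) r ≤ M.spr s b r

/-- `M.PosReachLoop T r Sel`: in some execution of the algorithm (the safe actions of the
initialization and the minimizing actions are chosen arbitrarily) the repeat-loop is entered with
the vector `r` and the selector `Sel`. -/
inductive CMDP.PosReachLoop (M : CMDP S A) (T : Set S) :
    (S → ℕ∞) → CounterSelector S A M.cap → Prop
  | start (α : S → A) (hα : ∀ s, M.safe s < ⊤ → M.IsSafeAction s (α s)) :
      M.PosReachLoop T (M.startVector T) (M.startSelector α)
  | iterate (r : S → ℕ∞) (Sel : CounterSelector S A M.cap) (α : S → A)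
      (h : M.PosReachLoop T r Sel) (hα : M.IsArgmin T r α) (hne : M.nextVector T r ≠ r) :
      M.PosReachLoop T (M.nextVector T r) (M.nextSelector T r (M.nextVector T r) α Sel)

/-- The algorithm for safe positive reachability of `T` in `M` may return `(r', Sel')`: these are
the vector and the selector after an iteration that does not change the vector. -/
def CMDP.PosReachReturns (M : CMDP S A) (T : Set S) (r' : S → ℕ∞)
    (Sel' : CounterSelector S A M.cap) : Prop :=
  ∃ r Sel α, M.PosReachLoop T r Sel ∧ M.IsArgmin T r α ∧
    r' = M.nextVector T r ∧ Sel' = M.nextSelector T r r' α Sel ∧ r' = r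

/-! ### The algorithm computing the reload set -/

/-- The reload states in `Rel` whose safe positive reachability value in `M(Rel)` exceeds the
capacity. -/
def CMDP.toRemove [Finite S] [Finite A] (M : CMDP S A) (T : Set S) (Rel : Set S) : Set S :=
  {s ∈ Rel | (M.cap : ℕ∞) < (M.withReload Rel).safePosReach T s}

/-- `Rel` occurs as the contents of the reload variable during the algorithm. -/
inductive CMDP.BuchiLoop [Finite S] [Finite A] (M : CMDP S A) (T : Set S) : Set S → Prop
  | start : M.BuchiLoop T M.reload
  | iterate (Rel : Set S) (h : M.BuchiLoop T Rel) : M.BuchiLoop T (Rel \ M.toRemove T Rel)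

/-- `R'` is the contents of the reload variable when the algorithm terminates. -/
def CMDP.BuchiTerminates [Finite S] [Finite A] (M : CMDP S A) (T R' : Set S) : Prop :=
  M.BuchiLoop T R' ∧ M.toRemove T R' = ∅

end ConsumptionMDP

end

noncomputable section

namespace ConsumptionMDP

variable {S A : Type*}

/-! ### Basic facts on levels and runs -/

/-! Safety is first made local. A level `n ≤ cap` is safe in `s` exactly when some action leads all
successors to levels that are safe there (`exists_staysSafe_of_le`, `StaysSafe.safe_le`). Algorithm
3 is then a decreasing iteration of a monotone operator: outside `T`, one successor is allowed to
make progress towards `T` while all the others merely stay safe. Its fixpoint `r` bounds from below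
every level from which a safe strategy has a run that visits `T`, by induction on the time until the
visit (`le_level_of_visit`). Conversely, from level `r s` the computed selector keeps every run safe
and has a positive chance of visiting `T`, by induction on the iterations
(`PosReachLoop.exists_mayVisit`). Hence the algorithm decides safe positive reachability. If
moreover `r` is finite at every reload state, it is `0` there. A play from a safe configuration that
cannot visit `T` would then never meet a reload state, and so would continue forever on a finite
resource, which a decreasing CMDP forbids (`IsDecreasing.not_forever`). So `T` is reachable from
every safe configuration. There are finitely many configurations, which gives a uniform number of
steps and a uniform positive probability, and hence almost surely infinitely many visits
(`prob_buchiRuns_eq_one`). Algorithm 4 enforces the condition on reload states and loses nothing.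
From any point it can reach, a Büchi-safe strategy can still visit `T`, so no reload state that it
meets is ever removed (`BuchiLoop.mem_of_isBuchiSafe`). It therefore remains Büchi-safe in `M(R')`,
which gives `r ≤ SafeBüchi`. Strategies safe in `M(R')` are safe in `M` because extra reloads only
raise levels (`IsSafe.of_withReload`), which gives the other inequality. -/

/-- The amount of the resource available for an action played in `s` at level `m`. -/
def CMDP.avail (M : CMDP S A) (s : S) (m : ℕ) : ℕ :=
  open Classical in if s ∈ M.reload then M.cap else m

lemma CMDP.avail_of_mem {M : CMDP S A} {s : S} (h : s ∈ M.reload) (m : ℕ) :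
    M.avail s m = M.cap := if_pos h

lemma CMDP.avail_of_notMem {M : CMDP S A} {s : S} (h : s ∉ M.reload) (m : ℕ) :
    M.avail s m = m := if_neg h

lemma CMDP.avail_le_cap (M : CMDP S A) (s : S) {m : ℕ} (h : m ≤ M.cap) :
    M.avail s m ≤ M.cap := by
  unfold CMDP.avail; split_ifs <;> simp [h]

lemma CMDP.avail_mono (M : CMDP S A) (s : S) {m n : ℕ} (h : m ≤ n) :
    M.avail s m ≤ M.avail s n := by
  unfold CMDP.avail; split_ifs <;> simp [h]

lemma eq_bot_or_exists_eq_natCast (x : WithBot ℕ) : x = ⊥ ∨ ∃ m : ℕ, x = m := by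
  induction x with
  | bot => exact Or.inl rfl
  | coe m => exact Or.inr ⟨m, rfl⟩

lemma CMDP.updateLevel_coe (M : CMDP S A) (m : ℕ) (s : S) (a : A) :
    M.updateLevel m s a =
      if M.cost s a ≤ M.avail s m then ((M.avail s m - M.cost s a : ℕ) : WithBot ℕ) else ⊥ := by
  classical
  unfold CMDP.avail
  change (if s ∈ M.reload then
    if M.cost s a ≤ M.cap then ((M.cap - M.cost s a : ℕ) : WithBot ℕ) else ⊥
    else if M.cost s a ≤ m then ((m - M.cost s a : ℕ) : WithBot ℕ) else ⊥) = _
  split_ifs <;> rfl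

lemma CMDP.updateLevel_eq_coe_iff (M : CMDP S A) (m m' : ℕ) (s : S) (a : A) :
    M.updateLevel m s a = (m' : WithBot ℕ) ↔ M.cost s a + m' = M.avail s m := by
  rw [CMDP.updateLevel_coe]
  split_ifs with h
  · rw [Nat.cast_inj]; omega
  · constructor
    · intro h'; exact absurd h' (WithBot.bot_ne_coe)
    · intro h'; omega

lemma CMDP.succ_nonempty (M : CMDP S A) (s : S) (a : A) : (M.succ s a).Nonempty := by
  obtain ⟨t, ht⟩ := (M.trans s a).support_nonempty
  exact ⟨t, pos_iff_ne_zero.2 ((PMF.mem_support_iff _ _).1 ht)⟩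

/-- The number of actions of a history. -/
def History.length : History S A → ℕ
  | .single _ => 0
  | .snoc β _ _ => β.length + 1

@[simp] lemma Run.pref_length (ρ : Run S A) (n : ℕ) : (Run.pref ρ n).length = n := by
  induction n with
  | zero => rfl
  | succ n ih => simp [Run.pref, History.length, ih]

@[simp] lemma Run.pref_last (ρ : Run S A) (n : ℕ) : (Run.pref ρ n).last = (ρ n).state := by
  cases n <;> rfl

@[simp] lemma Run.pref_first (ρ : Run S A) (n : ℕ) : (Run.pref ρ n).first = (ρ 0).state := by
  induction n with
  | zero => rfl
  | succ n ih => simpa [Run.pref, History.first] using ih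

lemma Run.pref_congr {ρ ρ' : Run S A} {n : ℕ} (h : ∀ i < n, ρ i = ρ' i)
    (hn : (ρ n).state = (ρ' n).state) : Run.pref ρ n = Run.pref ρ' n := by
  induction n with
  | zero => simp [Run.pref, hn]
  | succ n ih =>
    rw [Run.pref, Run.pref, h n n.lt_succ_self, hn,
      ih (fun i hi => h i (by omega)) (by rw [h n n.lt_succ_self])]

lemma Run.pref_eq_of_le {ρ ρ' : Run S A} {n m : ℕ} (h : Run.pref ρ n = Run.pref ρ' n)
    (hm : m ≤ n) : Run.pref ρ m = Run.pref ρ' m := by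
  induction n, hm using Nat.le_induction with
  | base => exact h
  | succ n _ ih =>
    simp only [Run.pref, History.snoc.injEq] at h
    exact ih h.1

lemma Run.state_eq_of_pref_eq {ρ ρ' : Run S A} {n m : ℕ} (h : Run.pref ρ n = Run.pref ρ' n)
    (hm : m ≤ n) : (ρ m).state = (ρ' m).state := by
  rw [← Run.pref_last, Run.pref_eq_of_le h hm, Run.pref_last]

lemma Step.ext' {x y : Step S A} (h₁ : x.state = y.state) (h₂ : x.act = y.act) : x = y :=
  Prod.ext h₁ h₂

/-- A prefix omits the action at its last position; compatibility with the same `σ` recovers it. -/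
lemma CMDP.eq_of_pref_eq {M : CMDP S A} {σ : Strategy S A} {s : S} {ρ ρ' : Run S A}
    (hρ : ρ ∈ M.compatible σ s) (hρ' : ρ' ∈ M.compatible σ s) {n m : ℕ}
    (h : Run.pref ρ n = Run.pref ρ' n) (hm : m ≤ n) : ρ m = ρ' m := by
  refine Step.ext' (Run.state_eq_of_pref_eq h hm) ?_
  rw [(hρ.2 m).1, (hρ'.2 m).1, Run.pref_eq_of_le h hm]

lemma CMDP.updateLevel_pref_succ (M : CMDP S A) (d : WithBot ℕ) (ρ : Run S A) (n : ℕ) :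
    M.level d (Run.pref ρ (n + 1)) =
      M.updateLevel (M.level d (Run.pref ρ n)) (ρ n).state (ρ n).act := by
  rw [Run.pref, CMDP.level, Run.pref_last]

/-- The history that arises from `s` when the actions are chosen by `σ` and the successor states
by `next`. -/
def playHistory (σ : Strategy S A) (next : History S A → S) (s : S) : ℕ → History S A
  | 0 => .single s
  | n + 1 => .snoc (playHistory σ next s n) (σ (playHistory σ next s n))
      (next (playHistory σ next s n))

/-- The run that arises from `s` when the actions are chosen by `σ` and the successor states
by `next`. -/
def playRun (σ : Strategy S A) (next : History S A → S) (s : S) : Run S A :=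
  fun n => ((playHistory σ next s n).last, σ (playHistory σ next s n))

lemma pref_playRun (σ : Strategy S A) (next : History S A → S) (s : S) (n : ℕ) :
    Run.pref (playRun σ next s) n = playHistory σ next s n := by
  induction n with
  | zero => rfl
  | succ n ih => rw [Run.pref, ih]; rfl

lemma CMDP.playRun_mem_compatible (M : CMDP S A) (σ : Strategy S A) (next : History S A → S)
    (s : S) (h : ∀ n, next (playHistory σ next s n) ∈
      M.succ (playHistory σ next s n).last (σ (playHistory σ next s n))) :
    playRun σ next s ∈ M.compatible σ s :=
  ⟨rfl, fun i => ⟨by rw [pref_playRun]; rfl, h i⟩⟩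

lemma CMDP.compatible_nonempty (M : CMDP S A) (σ : Strategy S A) (s : S) :
    (M.compatible σ s).Nonempty :=
  ⟨_, M.playRun_mem_compatible σ (fun h => (M.succ_nonempty h.last (σ h)).some) s
    fun _ => (M.succ_nonempty _ _).some_mem⟩

/-- Any successor state may follow a prefix of a compatible run. -/
lemma CMDP.exists_compatible_step {M : CMDP S A} {σ : Strategy S A} {s t : S} {ρ : Run S A}
    (hρ : ρ ∈ M.compatible σ s) (n : ℕ) (ht : t ∈ M.succ (ρ n).state (ρ n).act) :
    ∃ ρ' ∈ M.compatible σ s, Run.pref ρ' n = Run.pref ρ n ∧ (ρ' (n + 1)).state = t := by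
  classical
  -- The successors copy `ρ` before position `n`, branch to `t` there, and are arbitrary afterwards.
  let next : History S A → S := fun h =>
    if h.length < n then (ρ (h.length + 1)).state else
      if h.length = n then t else (M.succ_nonempty h.last (σ h)).some
  have hlen : ∀ i, (playHistory σ next s i).length = i := fun i => by
    rw [← pref_playRun, Run.pref_length]
  have hpre : ∀ i ≤ n, playHistory σ next s i = Run.pref ρ i := by
    intro i hi
    induction i with
    | zero => simp [playHistory, Run.pref, hρ.1]
    | succ i ih =>
      have hi' := ih (by omega)
      have hn : next (Run.pref ρ i) = (ρ (i + 1)).state := by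
        simp only [next, Run.pref_length]
        rw [if_pos (by omega)]
      rw [playHistory, hi', hn, Run.pref, (hρ.2 i).1]
  refine ⟨playRun σ next s, M.playRun_mem_compatible σ next s fun i => ?_, ?_, ?_⟩
  · rcases lt_trichotomy i n with hi | rfl | hi
    · have hn : next (playHistory σ next s i) = (ρ (i + 1)).state := by
        simp only [next, hlen]; rw [if_pos hi]
      rw [hn, hpre i hi.le, Run.pref_last, ← (hρ.2 i).1]
      exact (hρ.2 i).2
    · have hn : next (playHistory σ next s i) = t := by
        simp only [next, hlen]; simp
      rw [hn, hpre i le_rfl, Run.pref_last, ← (hρ.2 i).1]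
      exact ht
    · have hn : next (playHistory σ next s i) = (M.succ_nonempty (playHistory σ next s i).last
          (σ (playHistory σ next s i))).some := by
        simp only [next, hlen]; rw [if_neg (by omega), if_neg (by omega)]
      rw [hn]; exact Set.Nonempty.some_mem _
  · rw [pref_playRun, hpre n le_rfl]
  · change next (playHistory σ next s n) = t
    simp only [next, hlen]; simp

/-- If a strategy plays `f` depending on the current state and level, then a relation between
states and levels that is closed under `f` is an invariant. -/
lemma CMDP.exists_level_of_invariant {M : CMDP S A} {σ : Strategy S A} {s : S} {d : ℕ}
    (f : S → ℕ → A) (I : S → ℕ → Prop)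
    (hσ : ∀ (h : History S A) (m : ℕ), h.first = s → M.level d h = m → σ h = f h.last m)
    (hI : ∀ s m, I s m → ∃ m' : ℕ, M.updateLevel m s (f s m) = m' ∧
      ∀ t ∈ M.succ s (f s m), I t m')
    (hs : I s d) {ρ : Run S A} (hρ : ρ ∈ M.compatible σ s) (n : ℕ) :
    ∃ m : ℕ, M.level d (Run.pref ρ n) = m ∧ (ρ n).act = f (ρ n).state m ∧ I (ρ n).state m := by
  have key : ∀ n (m : ℕ), M.level d (Run.pref ρ n) = m → (ρ n).act = f (ρ n).state m := by
    intro n m hm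
    rw [(hρ.2 n).1, hσ _ m (by rw [Run.pref_first, hρ.1]) hm, Run.pref_last]
  induction n with
  | zero => exact ⟨d, rfl, key 0 d rfl, by rw [hρ.1]; exact hs⟩
  | succ n ih =>
    obtain ⟨m, hm, ha, hIm⟩ := ih
    obtain ⟨m', hm', hsucc⟩ := hI _ _ hIm
    have hl : M.level d (Run.pref ρ (n + 1)) = m' := by
      rw [CMDP.updateLevel_pref_succ, hm, ha, hm']
    exact ⟨m', hl, key _ _ hl, hsucc _ (by rw [← ha]; exact (hρ.2 n).2)⟩

/-- A relation between states and levels from which one can always play on without exhausting the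
resource consists of safe levels. -/
lemma CMDP.exists_isSafe_of_closed {M : CMDP S A} (I : S → ℕ → Prop)
    (hI : ∀ s m, I s m → ∃ (a : A) (m' : ℕ), M.updateLevel m s a = m' ∧
      ∀ t ∈ M.succ s a, I t m') {s : S} {d : ℕ} (hs : I s d) :
    ∃ σ, M.IsSafe σ d s := by
  classical
  have a₀ : A := (hI s d hs).choose
  let f : S → ℕ → A := fun s m => if h : I s m then (hI s m h).choose else a₀
  refine ⟨fun h => f h.last ((M.level d h).unbotD 0), fun ρ hρ n => ?_⟩
  obtain ⟨m, hm, -⟩ := M.exists_level_of_invariant f I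
    (fun h m _ hm => by simp only [hm]; rfl)
    (fun s m h => by simp only [f, dif_pos h]; exact (hI s m h).choose_spec) hs hρ n
  rw [hm]; exact WithBot.coe_ne_bot

lemma CMDP.level_le_cap {M : CMDP S A} {d : ℕ} (hd : d ≤ M.cap) :
    ∀ (h : History S A) (m : ℕ), M.level d h = m → m ≤ M.cap := by
  intro h
  induction h with
  | single s => intro m hm; rw [CMDP.level, Nat.cast_inj] at hm; omega
  | snoc β a t ih =>
    intro m hm
    rw [CMDP.level] at hm
    obtain hb | ⟨k, hk⟩ := eq_bot_or_exists_eq_natCast (M.level d β)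
    · rw [hb] at hm; exact absurd hm WithBot.bot_ne_coe
    · rw [hk] at hm
      have h₁ := (M.updateLevel_eq_coe_iff _ _ _ _).1 hm
      have := M.avail_le_cap β.last (ih k hk)
      omega

lemma CMDP.IsSafe.exists_level {M : CMDP S A} {σ : Strategy S A} {s : S} {d : ℕ}
    (h : M.IsSafe σ d s) {ρ : Run S A} (hρ : ρ ∈ M.compatible σ s) (n : ℕ) :
    ∃ m : ℕ, M.level d (Run.pref ρ n) = m :=
  (eq_bot_or_exists_eq_natCast _).resolve_left (h hρ n)

/-! ### Minimal safe levels -/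

lemma CMDP.minLoad_le {M : CMDP S A} {P : Strategy S A → ℕ → Prop} {σ : Strategy S A} {d : ℕ}
    (hd : d ≤ M.cap) (h : P σ d) : M.minLoad P ≤ d :=
  sInf_le ⟨d, hd, ⟨σ, h⟩, rfl⟩

lemma CMDP.exists_of_minLoad_ne_top {M : CMDP S A} {P : Strategy S A → ℕ → Prop}
    (h : M.minLoad P ≠ ⊤) : ∃ d : ℕ, d ≤ M.cap ∧ (∃ σ, P σ d) ∧ M.minLoad P = d := by
  refine csInf_mem (s := {x : ℕ∞ | ∃ d : ℕ, d ≤ M.cap ∧ (∃ σ, P σ d) ∧ x = d}) ?_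
  by_contra hne
  rw [Set.not_nonempty_iff_eq_empty] at hne
  exact h (by rw [CMDP.minLoad, hne, sInf_empty])

lemma natCast_add_le_natCast_iff (c v : ℕ) (x : ℕ∞) :
    (c : ℕ∞) + x ≤ v ↔ ∃ m : ℕ, c + m = v ∧ x ≤ m := by
  constructor
  · intro h
    have hx : x ≠ ⊤ := by
      rintro rfl
      rw [add_top, top_le_iff] at h
      exact ENat.natCast_ne_top v h
    lift x to ℕ using hx
    have : c + x ≤ v := by exact_mod_cast h
    exact ⟨v - c, by omega, by exact_mod_cast (by omega : x ≤ v - c)⟩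
  · rintro ⟨m, rfl, h⟩
    push_cast
    gcongr

/-- Playing `a` in `s` at level `n` leads to successors `t` with a level of at least `Safe(t)`. -/
def CMDP.StaysSafe (M : CMDP S A) (s : S) (a : A) (n : ℕ) : Prop :=
  ∃ m : ℕ, M.cost s a + m = M.avail s n ∧ ∀ t ∈ M.succ s a, M.safe t ≤ m

lemma CMDP.StaysSafe.mono {M : CMDP S A} {s : S} {a : A} {n n' : ℕ} (h : M.StaysSafe s a n)
    (hn : M.avail s n ≤ M.avail s n') : M.StaysSafe s a n' := by
  obtain ⟨m, hm, ht⟩ := h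
  refine ⟨M.avail s n' - M.cost s a, by omega, fun t h => (ht t h).trans ?_⟩
  exact_mod_cast (by omega : m ≤ M.avail s n' - M.cost s a)

/-- The configurations met by `σ` are closed under some choice of action with all its successors, so
each of them is itself a safe start. -/
lemma CMDP.IsSafe.safe_le_level {M : CMDP S A} {σ : Strategy S A} {s : S} {d : ℕ}
    (h : M.IsSafe σ d s) (hd : d ≤ M.cap) {ρ : Run S A} (hρ : ρ ∈ M.compatible σ s) {n m : ℕ}
    (hm : M.level d (Run.pref ρ n) = m) : M.safe (ρ n).state ≤ m := by
  obtain ⟨τ, hτ⟩ := M.exists_isSafe_of_closed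
    (fun t m => ∃ ρ ∈ M.compatible σ s, ∃ n, (ρ n).state = t ∧ M.level d (Run.pref ρ n) = m)
    (by
      rintro _ m ⟨ρ, hρ, n, rfl, hm⟩
      obtain ⟨m', hm'⟩ := h.exists_level hρ (n + 1)
      refine ⟨(ρ n).act, m', by rw [← hm', M.updateLevel_pref_succ, hm], fun t ht => ?_⟩
      obtain ⟨ρ', hρ', hpre, hst⟩ := M.exists_compatible_step hρ n ht
      have hn : ρ' n = ρ n := M.eq_of_pref_eq hρ' hρ hpre le_rfl
      exact ⟨ρ', hρ', n + 1, hst, by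
        rw [M.updateLevel_pref_succ, hpre, hn, ← M.updateLevel_pref_succ, hm']⟩)
    ⟨ρ, hρ, n, rfl, hm⟩
  exact M.minLoad_le (M.level_le_cap hd _ _ hm) hτ

lemma CMDP.IsSafe.cost_add_level {M : CMDP S A} {σ : Strategy S A} {s : S} {d : ℕ}
    (h : M.IsSafe σ d s) {ρ : Run S A} (hρ : ρ ∈ M.compatible σ s) {n m : ℕ}
    (hm : M.level d (Run.pref ρ n) = m) :
    ∃ m' : ℕ, M.level d (Run.pref ρ (n + 1)) = m' ∧
      M.cost (ρ n).state (ρ n).act + m' = M.avail (ρ n).state m := by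
  obtain ⟨m', hm'⟩ := h.exists_level hρ (n + 1)
  refine ⟨m', hm', ?_⟩
  rw [← M.updateLevel_eq_coe_iff, ← hm, ← M.updateLevel_pref_succ, hm']

lemma CMDP.IsSafe.safe_succ_le_level {M : CMDP S A} {σ : Strategy S A} {s : S} {d : ℕ}
    (h : M.IsSafe σ d s) (hd : d ≤ M.cap) {ρ : Run S A} (hρ : ρ ∈ M.compatible σ s) {n m : ℕ}
    (hm : M.level d (Run.pref ρ (n + 1)) = m) {t : S} (ht : t ∈ M.succ (ρ n).state (ρ n).act) :
    M.safe t ≤ m := by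
  obtain ⟨ρ', hρ', hpre, hst⟩ := M.exists_compatible_step hρ n ht
  have hn : ρ' n = ρ n := M.eq_of_pref_eq hρ' hρ hpre le_rfl
  rw [← hst]
  refine h.safe_le_level hd hρ' ?_
  rw [M.updateLevel_pref_succ, hpre, hn, ← M.updateLevel_pref_succ, hm]

lemma CMDP.exists_staysSafe {M : CMDP S A} {s : S} {d : ℕ} (h : M.safe s = d) :
    ∃ a, M.StaysSafe s a d := by
  obtain ⟨d', hd, ⟨σ, hσ⟩, hd'⟩ := M.exists_of_minLoad_ne_top
    (P := fun σ d => M.IsSafe σ d s) (by rw [← CMDP.safe, h]; exact ENat.natCast_ne_top d)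
  obtain rfl : d = d' := by exact_mod_cast h.symm.trans hd'
  obtain ⟨ρ, hρ⟩ := M.compatible_nonempty σ s
  obtain ⟨m', hm', hc⟩ := hσ.cost_add_level hρ (n := 0) (m := d) rfl
  rw [hρ.1] at hc
  refine ⟨(ρ 0).act, m', hc, fun t ht => ?_⟩
  exact hσ.safe_succ_le_level hd hρ hm' (by rwa [hρ.1])

lemma CMDP.exists_staysSafe_of_le {M : CMDP S A} {s : S} {n : ℕ} (h : M.safe s ≤ n) :
    ∃ a, M.StaysSafe s a n := by
  have ht : M.safe s ≠ ⊤ := ne_top_of_le_ne_top (ENat.natCast_ne_top n) h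
  obtain ⟨d, hd⟩ := ENat.ne_top_iff_exists.1 ht
  obtain ⟨a, ha⟩ := M.exists_staysSafe hd.symm
  rw [← hd] at h
  exact ⟨a, ha.mono (M.avail_mono s (by exact_mod_cast h))⟩

/-- The safe configurations stay closed when the single configuration `(s, n)` is added to them. -/
lemma CMDP.StaysSafe.safe_le {M : CMDP S A} {s : S} {a : A} {n : ℕ} (h : M.StaysSafe s a n)
    (hn : n ≤ M.cap) : M.safe s ≤ n := by
  obtain ⟨σ, hσ⟩ := M.exists_isSafe_of_closed
    (fun t m => M.safe t ≤ m ∨ (t = s ∧ m = n))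
    (by
      have key : ∀ t m, (∃ b, M.StaysSafe t b m) → ∃ (b : A) (m' : ℕ),
          M.updateLevel m t b = m' ∧ ∀ u ∈ M.succ t b, M.safe u ≤ m' ∨ (u = s ∧ m' = n) := by
        rintro t m ⟨b, m', hm', hu⟩
        exact ⟨b, m', (M.updateLevel_eq_coe_iff _ _ _ _).2 hm', fun u h => Or.inl (hu u h)⟩
      rintro t m (ht | ⟨rfl, rfl⟩)
      · exact key t m (M.exists_staysSafe_of_le ht)
      · exact key t m ⟨a, h⟩)
    (Or.inr ⟨rfl, rfl⟩ : M.safe s ≤ n ∨ (s = s ∧ n = n))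
  exact M.minLoad_le hn hσ

lemma CMDP.isSafeAction_iff {M : CMDP S A} {s : S} {a : A} {d : ℕ} (h : M.safe s = d) :
    M.IsSafeAction s a ↔ M.StaysSafe s a d := by
  have hsup : ∀ v : ℕ, (M.cost s a : ℕ∞) + (⨆ t ∈ M.succ s a, M.safe t) ≤ v ↔
      ∃ m : ℕ, M.cost s a + m = v ∧ ∀ t ∈ M.succ s a, M.safe t ≤ m := fun v => by
    simp only [natCast_add_le_natCast_iff, iSup_le_iff]
  unfold CMDP.IsSafeAction CMDP.StaysSafe
  rw [h, hsup, hsup]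
  by_cases hs : s ∈ M.reload
  · simp [hs, M.avail_of_mem hs]
  · simp [hs, M.avail_of_notMem hs]

/-- The only content is at a reload state, where the level on arrival is irrelevant. -/
lemma CMDP.safe_le_of_avail {M : CMDP S A} {s : S} {n : ℕ} (hn : n ≤ M.cap)
    (h : M.safe s ≤ M.avail s n) : M.safe s ≤ n := by
  by_cases hs : s ∈ M.reload
  · obtain ⟨a, ha⟩ := M.exists_staysSafe_of_le h
    exact (ha.mono (by simp [M.avail_of_mem hs])).safe_le hn
  · rwa [M.avail_of_notMem hs] at h

lemma CMDP.le_avail (M : CMDP S A) (s : S) {n : ℕ} (hn : n ≤ M.cap) : n ≤ M.avail s n := by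
  unfold CMDP.avail; split_ifs <;> simp [hn]

/-! ### The algorithm for safe positive reachability -/

/-- Playing `a` in `s` at level `n` leads to successors `t` with a level of at least `Safe(t)`
or, for at least one successor `t`, of at least `x t`. -/
def CMDP.StaysSafeTo (M : CMDP S A) (x : S → ℕ∞) (s : S) (a : A) (n : ℕ) : Prop :=
  ∃ m : ℕ, M.cost s a + m = M.avail s n ∧
    ∃ t ∈ M.succ s a, x t ≤ m ∧ ∀ t' ∈ M.succ s a, t' ≠ t → M.safe t' ≤ m

/-- A bound by a finite `m` is the strict bound by `m + 1`, and a strict bound on an infimum is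
witnessed. No finiteness of the index set is needed, and an empty infimum is `⊤`. -/
lemma iInf_mem_le_natCast_iff {α : Type*} (s : Set α) (g : α → ℕ∞) (m : ℕ) :
    (⨅ t ∈ s, g t) ≤ m ↔ ∃ t ∈ s, g t ≤ m := by
  have h : ∀ x : ℕ∞, x ≤ m ↔ x < (m + 1 : ℕ) := fun x => by
    push_cast
    exact (ENat.lt_add_one_iff (ENat.natCast_ne_top m)).symm
  simp only [h, iInf_lt_iff, exists_prop]

lemma iInf_le_natCast_iff {α : Type*} (g : α → ℕ∞) (m : ℕ) :
    (⨅ t, g t) ≤ m ↔ ∃ t, g t ≤ m := by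
  simpa using iInf_mem_le_natCast_iff Set.univ g m

lemma CMDP.spr_le_iff (M : CMDP S A) (x : S → ℕ∞) (s : S) (a : A) (n : ℕ) :
    M.spr s a x ≤ M.avail s n ↔ M.StaysSafeTo x s a n := by
  unfold CMDP.spr CMDP.StaysSafeTo
  simp only [natCast_add_le_natCast_iff, iInf_mem_le_natCast_iff, max_le_iff, iSup_le_iff,
    Set.mem_sdiff, Set.mem_singleton_iff, and_imp]

/-- Both truncations amount to comparing with the available amount. This lets reload and ordinary
states be treated uniformly from here on. -/
lemma CMDP.trunc_le_iff (M : CMDP S A) (x : S → ℕ∞) (s : S) {n : ℕ} (hn : n ≤ M.cap) :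
    M.trunc x s ≤ n ↔ x s ≤ M.avail s n := by
  have hn' : (n : ℕ∞) ≤ M.cap := by exact_mod_cast hn
  unfold CMDP.trunc CMDP.avail
  split_ifs with h₁ h₂ h₂
  · exact ⟨fun h => absurd (top_le_iff.1 h) (ENat.natCast_ne_top n), fun h => absurd h (not_le.2 h₁)⟩
  · exact ⟨fun h => absurd (top_le_iff.1 h) (ENat.natCast_ne_top n),
      fun h => absurd (h.trans hn') (not_le.2 h₁)⟩
  · exact ⟨fun _ => not_lt.1 h₁, fun _ => zero_le⟩
  · rfl

lemma CMDP.trunc_eq_top_or (M : CMDP S A) (x : S → ℕ∞) (s : S) :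
    M.trunc x s = ⊤ ∨ ∃ n : ℕ, n ≤ M.cap ∧ M.trunc x s = n := by
  rcases lt_or_ge (M.cap : ℕ∞) (M.trunc x s) with h | h
  · left
    unfold CMDP.trunc at h ⊢
    split_ifs at h ⊢ with h₁ h₂
    · rfl
    · simp at h
    · exact absurd h h₁
  · right
    obtain ⟨n, hn⟩ := ENat.ne_top_iff_exists.1 (ne_top_of_le_ne_top (ENat.natCast_ne_top _) h)
    exact ⟨n, by rw [← hn] at h; exact_mod_cast h, hn.symm⟩

lemma CMDP.nextVector_le_iff_of_mem (M : CMDP S A) {T : Set S} (r : S → ℕ∞) {s : S} (hs : s ∈ T)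
    {n : ℕ} (hn : n ≤ M.cap) : M.nextVector T r s ≤ n ↔ r s ≤ M.avail s n := by
  rw [CMDP.nextVector, M.trunc_le_iff _ _ hn, if_pos hs]

lemma CMDP.nextVector_le_iff (M : CMDP S A) {T : Set S} (r : S → ℕ∞) {s : S} (hs : s ∉ T)
    {n : ℕ} (hn : n ≤ M.cap) :
    M.nextVector T r s ≤ n ↔ ∃ a, M.StaysSafeTo r s a n := by
  rw [CMDP.nextVector, M.trunc_le_iff _ _ hn, if_neg hs, iInf_le_natCast_iff]
  simp only [M.spr_le_iff]

lemma CMDP.IsArgmin.nextVector_le_iff {M : CMDP S A} {T : Set S} {r : S → ℕ∞} {α : S → A}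
    (hα : M.IsArgmin T r α) {s : S} (hs : s ∉ T) {n : ℕ} (hn : n ≤ M.cap) :
    M.nextVector T r s ≤ n ↔ M.StaysSafeTo r s (α s) n := by
  rw [CMDP.nextVector, M.trunc_le_iff _ _ hn, if_neg hs, iInf_le_natCast_iff, ← M.spr_le_iff]
  exact ⟨fun ⟨a, ha⟩ => (hα s hs a).trans ha, fun h => ⟨_, h⟩⟩

/-- The components of a vector are infinite or at most the capacity. -/
def CMDP.IsTruncated (M : CMDP S A) (r : S → ℕ∞) : Prop :=
  ∀ s, r s = ⊤ ∨ ∃ n : ℕ, n ≤ M.cap ∧ r s = n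

lemma CMDP.le_of_forall_natCast (M : CMDP S A) {x y : ℕ∞}
    (hy : y = ⊤ ∨ ∃ n : ℕ, n ≤ M.cap ∧ y = n)
    (h : ∀ n : ℕ, n ≤ M.cap → y ≤ n → x ≤ n) : x ≤ y := by
  rcases hy with rfl | ⟨n, hn, rfl⟩
  · exact le_top
  · exact h n hn le_rfl

lemma CMDP.isTruncated_nextVector (M : CMDP S A) (T : Set S) (r : S → ℕ∞) :
    M.IsTruncated (M.nextVector T r) := fun s => M.trunc_eq_top_or _ s

lemma CMDP.isTruncated_safe (M : CMDP S A) : M.IsTruncated M.safe := by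
  intro s
  by_cases h : M.safe s = ⊤
  · exact Or.inl h
  · obtain ⟨d, hd, -, hd'⟩ := M.exists_of_minLoad_ne_top (P := fun σ d => M.IsSafe σ d s) h
    exact Or.inr ⟨d, hd, hd'⟩

lemma CMDP.nextVector_mono (M : CMDP S A) (T : Set S) {r r' : S → ℕ∞} (h : r ≤ r') :
    M.nextVector T r ≤ M.nextVector T r' := by
  intro s
  refine M.le_of_forall_natCast (M.isTruncated_nextVector T r' s) fun n hn hle => ?_
  by_cases hs : s ∈ T
  · rw [M.nextVector_le_iff_of_mem _ hs hn] at hle ⊢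
    exact (h s).trans hle
  · rw [M.nextVector_le_iff _ hs hn] at hle ⊢
    obtain ⟨a, m, hm, t, ht, hx, h'⟩ := hle
    exact ⟨a, m, hm, t, ht, (h t).trans hx, h'⟩

lemma CMDP.StaysSafeTo.staysSafe {M : CMDP S A} {r : S → ℕ∞} (hr : M.safe ≤ r) {s : S} {a : A}
    {n : ℕ} (h : M.StaysSafeTo r s a n) : M.StaysSafe s a n := by
  obtain ⟨m, hm, t, _, hx, h'⟩ := h
  refine ⟨m, hm, fun u hu => ?_⟩
  by_cases hut : u = t
  · rw [hut]; exact (hr t).trans hx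
  · exact h' u hu hut

lemma CMDP.safe_le_nextVector (M : CMDP S A) (T : Set S) {r : S → ℕ∞} (h : M.safe ≤ r) :
    M.safe ≤ M.nextVector T r := by
  intro s
  refine M.le_of_forall_natCast (M.isTruncated_nextVector T r s) fun n hn hle => ?_
  by_cases hs : s ∈ T
  · rw [M.nextVector_le_iff_of_mem _ hs hn] at hle
    exact M.safe_le_of_avail hn ((h s).trans hle)
  · rw [M.nextVector_le_iff _ hs hn] at hle
    obtain ⟨a, ha⟩ := hle
    exact (ha.staysSafe h).safe_le hn

lemma CMDP.nextVector_le_safe (M : CMDP S A) {T : Set S} {r : S → ℕ∞} {s : S} (hs : s ∈ T)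
    (h : r s = M.safe s) : M.nextVector T r s ≤ M.safe s := by
  refine M.le_of_forall_natCast (M.isTruncated_safe s) fun n hn hle => ?_
  rw [M.nextVector_le_iff_of_mem _ hs hn, h]
  exact hle.trans (by exact_mod_cast M.le_avail s hn)

/-- The properties of the vector and the selector that hold throughout the algorithm. -/
structure CMDP.LoopInvariant (M : CMDP S A) (T : Set S) (r : S → ℕ∞)
    (Sel : CounterSelector S A M.cap) : Prop where
  truncated : M.IsTruncated r
  eq_safe : ∀ s ∈ T, r s = M.safe s
  safe_le : M.safe ≤ r
  nextVector_le : M.nextVector T r ≤ r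
  staysSafe : ∀ s n a, Sel s n = some a → M.StaysSafe s a n
  level_of_ne_none : ∀ s n, Sel s n ≠ none → ((n : ℕ) : ℕ∞) = M.safe s ∨ r s ≤ (n : ℕ)
  ne_none_of_eq_safe : ∀ s (n : Fin (M.cap + 1)), ((n : ℕ) : ℕ∞) = M.safe s → Sel s n ≠ none

/-- Monotonicity of the iteration operator propagates the descent `nextVector T r ≤ r`. A new rule
is safe since it uses a minimizer and `Safe ≤ r`. -/
lemma CMDP.PosReachLoop.loopInvariant {M : CMDP S A} {T : Set S} {r : S → ℕ∞}
    {Sel : CounterSelector S A M.cap} (h : M.PosReachLoop T r Sel) : M.LoopInvariant T r Sel := by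
  induction h with
  | start α hα =>
    have hT : ∀ s ∈ T, M.startVector T s = M.safe s := fun s hs => if_pos hs
    refine ⟨fun s => ?_, hT, fun s => ?_, fun s => ?_, fun s n a h => ?_, fun s n h => ?_,
      fun s n h => ?_⟩
    · by_cases hs : s ∈ T
      · rw [hT s hs]; exact M.isTruncated_safe s
      · exact Or.inl (if_neg hs)
    · by_cases hs : s ∈ T
      · rw [hT s hs]
      · rw [CMDP.startVector, if_neg hs]; exact le_top
    · by_cases hs : s ∈ T
      · rw [hT s hs]; exact M.nextVector_le_safe hs (hT s hs)
      · rw [CMDP.startVector, if_neg hs]; exact le_top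
    · unfold CMDP.startSelector at h
      split_ifs at h with hn
      obtain rfl := Option.some.inj h
      exact (M.isSafeAction_iff hn.symm).1 (hα s (by rw [← hn]; exact ENat.natCast_lt_top _))
    · unfold CMDP.startSelector at h
      split_ifs at h with hn
      · exact Or.inl hn
      · exact absurd rfl h
    · simp [CMDP.startSelector, h]
  | iterate r Sel α _ hα _ ih =>
    refine ⟨M.isTruncated_nextVector T r, fun s hs => ?_, M.safe_le_nextVector T ih.safe_le,
      M.nextVector_mono T ih.nextVector_le, fun s n a h => ?_, fun s n h => ?_, fun s n h => ?_⟩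
    · exact le_antisymm (M.nextVector_le_safe hs (ih.eq_safe s hs))
        (M.safe_le_nextVector T ih.safe_le s)
    · unfold CMDP.nextSelector at h
      split_ifs at h with hn
      · obtain rfl := Option.some.inj h
        exact ((hα.nextVector_le_iff hn.1 (Nat.lt_succ_iff.1 n.2)).1 hn.2.2.ge).staysSafe ih.safe_le
      · exact ih.staysSafe s n a h
    · unfold CMDP.nextSelector at h
      split_ifs at h with hn
      · exact Or.inr hn.2.2.ge
      · exact (ih.level_of_ne_none s n h).imp_right (ih.nextVector_le s).trans
    · unfold CMDP.nextSelector
      split_ifs with hn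
      · simp
      · exact ih.ne_none_of_eq_safe s n h

lemma CMDP.exists_isSafeAction [Nonempty A] (M : CMDP S A) (s : S) :
    ∃ a, M.safe s < ⊤ → M.IsSafeAction s a := by
  by_cases h : M.safe s < ⊤
  · obtain ⟨d, hd⟩ := ENat.ne_top_iff_exists.1 h.ne
    obtain ⟨a, ha⟩ := M.exists_staysSafe hd.symm
    exact ⟨a, fun _ => (M.isSafeAction_iff hd.symm).2 ha⟩
  · exact ⟨Classical.arbitrary A, fun h' => absurd h' h⟩

lemma CMDP.exists_isArgmin [Finite A] [Nonempty A] (M : CMDP S A) (T : Set S) (r : S → ℕ∞) :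
    ∃ α, M.IsArgmin T r α := by
  choose α hα using fun s => Finite.exists_min fun a => M.spr s a r
  exact ⟨α, fun s _ b => hα s b⟩

lemma CMDP.exists_posReachReturns [Finite S] [Finite A] [Nonempty A] (M : CMDP S A) (T : Set S) :
    ∃ r Sel, M.PosReachReturns T r Sel := by
  have key : ∀ r Sel, M.PosReachLoop T r Sel → ∃ r Sel, M.PosReachReturns T r Sel := by
    intro r
    -- The vectors strictly decrease in `S → ℕ∞`, which is well-founded because `S` is finite.
    induction r using WellFoundedLT.induction with
    | ind r ih =>
      intro Sel h
      obtain ⟨α, hα⟩ := M.exists_isArgmin T r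
      by_cases hne : M.nextVector T r = r
      · exact ⟨_, _, r, Sel, α, h, hα, rfl, rfl, hne⟩
      · exact ih _ (lt_of_le_of_ne h.loopInvariant.nextVector_le hne) _ (.iterate r Sel α h hα hne)
  choose α hα using M.exists_isSafeAction
  exact key _ _ (.start α hα)

/-- The final iteration decreases no component, hence writes no rule: the returned pair is already a
loop state. -/
lemma CMDP.PosReachReturns.posReachLoop {M : CMDP S A} {T : Set S} {r : S → ℕ∞}
    {Sel : CounterSelector S A M.cap} (h : M.PosReachReturns T r Sel) :
    M.PosReachLoop T r Sel ∧ M.nextVector T r = r := by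
  obtain ⟨r₀, Sel₀, α, hl, _, h₁, h₂, rfl⟩ := h
  refine ⟨?_, h₁.symm⟩
  have : Sel = Sel₀ := by
    rw [h₂]
    ext1 s; ext1 n
    simp [CMDP.nextSelector]
  rwa [this]

section Probability

/-! ### The probability measure on runs -/

open MeasureTheory ProbabilityTheory ProbabilityTheory.Kernel Preorder

/-- The runs that agree with `ρ` up to position `n`. -/
def cyl (ρ : Run S A) (n : ℕ) : Set (Run S A) := {ρ' | ∀ i ≤ n, ρ' i = ρ i}

lemma mem_cyl_self (ρ : Run S A) (n : ℕ) : ρ ∈ cyl ρ n := fun _ _ => rfl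

lemma cyl_eq_preimage (ρ : Run S A) (n : ℕ) :
    cyl ρ n = frestrictLe (π := fun _ : ℕ => Step S A) n ⁻¹' {frestrictLe n ρ} := by
  ext ρ'
  simp only [cyl, Set.mem_ofPred_eq, Set.mem_preimage, Set.mem_singleton_iff, funext_iff,
    frestrictLe_apply, Subtype.forall, Finset.mem_Iic]

lemma prefHistory_frestrictLe (ρ : Run S A) (n : ℕ) :
    prefHistory n (frestrictLe (π := fun _ : ℕ => Step S A) n ρ) = Run.pref ρ n :=
  Run.pref_congr (fun i hi => by simp [min_eq_left hi.le]) (by simp)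

/-- The first position of the runs from `s` under `σ`. -/
def startPrefix (σ : Strategy S A) (s : S) (_ : Finset.Iic 0) : Step S A := (s, σ (.single s))

lemma CMDP.stepPMF_apply_of_eq (M : CMDP S A) (σ : Strategy S A) (ρ : Run S A) (n : ℕ)
    (h : (ρ (n + 1)).act = σ (.snoc (Run.pref ρ n) (ρ n).act (ρ (n + 1)).state)) :
    M.trans (ρ n).state (ρ n).act (ρ (n + 1)).state ≤
      M.stepPMF σ n (frestrictLe n ρ) (ρ (n + 1)) := by
  classical
  let g : S → Step S A := fun t => ((t, σ (.snoc (Run.pref ρ n) (ρ n).act t)) : S × A)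
  have hg : M.stepPMF σ n (frestrictLe n ρ) = (M.trans (ρ n).state (ρ n).act).map g := by
    unfold CMDP.stepPMF
    rw [prefHistory_frestrictLe]
    rfl
  have hx : ρ (n + 1) = g (ρ (n + 1)).state := Step.ext' rfl h
  rw [hg, PMF.map_apply]
  refine le_trans ?_ (ENNReal.le_tsum (ρ (n + 1)).state)
  rw [if_pos hx]

lemma CMDP.of_stepPMF_ne_zero (M : CMDP S A) (σ : Strategy S A) (ρ : Run S A) (n : ℕ)
    (h : M.stepPMF σ n (frestrictLe n ρ) (ρ (n + 1)) ≠ 0) :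
    (ρ (n + 1)).act = σ (.snoc (Run.pref ρ n) (ρ n).act (ρ (n + 1)).state) ∧
      (ρ (n + 1)).state ∈ M.succ (ρ n).state (ρ n).act := by
  unfold CMDP.stepPMF at h
  rw [prefHistory_frestrictLe] at h
  obtain ⟨t, ht, hx⟩ := (PMF.mem_support_map_iff _ _ _).1 ((PMF.mem_support_iff _ _).2 h)
  have hs : (ρ (n + 1)).state = t := congrArg Step.state hx.symm
  have ha := congrArg Step.act hx.symm
  rw [hs]
  exact ⟨ha, pos_iff_ne_zero.2 ((PMF.mem_support_iff _ _).1 ht)⟩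

lemma measurableSet_avoid (T : Set S) (n m : ℕ) :
    MeasurableSet {ρ : Run S A | ∀ i, n < i → i ≤ m → (ρ i).state ∉ T} := by
  have : {ρ : Run S A | ∀ i, n < i → i ≤ m → (ρ i).state ∉ T} =
      ⋂ i, ⋂ (_ : n < i), ⋂ (_ : i ≤ m), (fun ρ : Run S A => ρ i) ⁻¹' {x | x.state ∉ T} := by
    ext; simp
  rw [this]
  exact MeasurableSet.iInter fun i => .iInter fun _ => .iInter fun _ =>
    measurable_pi_apply i (MeasurableSet.of_discrete)

variable [Finite S] [Finite A]

lemma CMDP.prob_eq (M : CMDP S A) (σ : Strategy S A) (s : S) :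
    M.prob σ s = traj (X := fun _ => Step S A) (M.stepKernel σ) 0 (startPrefix σ s) := rfl

instance (M : CMDP S A) (σ : Strategy S A) (s : S) : IsProbabilityMeasure (M.prob σ s) := by
  rw [M.prob_eq]; infer_instance

lemma measurableSet_cyl (ρ : Run S A) (n : ℕ) : MeasurableSet (cyl ρ n) := by
  rw [cyl_eq_preimage]
  exact measurable_frestrictLe n (measurableSet_singleton _)

lemma CMDP.prob_cyl (M : CMDP S A) (σ : Strategy S A) (s : S) (ρ : Run S A) (n : ℕ) :
    M.prob σ s (cyl ρ n) = partialTraj (X := fun _ => Step S A) (M.stepKernel σ) 0 n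
      (startPrefix σ s) {frestrictLe n ρ} := by
  rw [cyl_eq_preimage, ← Measure.map_apply (measurable_frestrictLe n) (measurableSet_singleton _),
    M.prob_eq, traj_map_frestrictLe_apply]

lemma CMDP.prob_cyl_zero (M : CMDP S A) (σ : Strategy S A) (s : S) {ρ : Run S A}
    (h₁ : (ρ 0).state = s) (h₂ : (ρ 0).act = σ (.single s)) : M.prob σ s (cyl ρ 0) = 1 := by
  rw [M.prob_cyl, partialTraj_self, Kernel.id_apply,
    Measure.dirac_apply' _ (measurableSet_singleton _)]
  refine Set.indicator_of_mem ?_ _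
  rw [Set.mem_singleton_iff]
  ext1 ⟨i, hi⟩
  obtain rfl : i = 0 := by simpa using hi
  exact (Step.ext' (y := ((s, σ (.single s)) : S × A)) h₁ h₂).symm

lemma CMDP.of_prob_cyl_zero_ne_zero (M : CMDP S A) (σ : Strategy S A) (s : S) {ρ : Run S A}
    (h : M.prob σ s (cyl ρ 0) ≠ 0) : (ρ 0).state = s ∧ (ρ 0).act = σ (.single s) := by
  rw [M.prob_cyl, partialTraj_self, Kernel.id_apply,
    Measure.dirac_apply' _ (measurableSet_singleton _)] at h
  have h' := Set.mem_of_indicator_ne_zero h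
  rw [Set.mem_singleton_iff] at h'
  have h0 := congrFun h' ⟨0, by simp⟩
  exact ⟨congrArg Step.state h0.symm, congrArg Step.act h0.symm⟩

/-- The longer cylinder is a rectangle for the pair (first positions, next position), whose law is
the composition of the partial trajectory with the step kernel. -/
lemma CMDP.prob_cyl_succ (M : CMDP S A) (σ : Strategy S A) (s : S) (ρ : Run S A) (n : ℕ) :
    M.prob σ s (cyl ρ (n + 1)) =
      M.stepPMF σ n (frestrictLe n ρ) (ρ (n + 1)) * M.prob σ s (cyl ρ n) := by
  have h : cyl ρ (n + 1) =
      (fun x : Run S A => (frestrictLe (π := fun _ => Step S A) n x, x (n + 1))) ⁻¹'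
      ({frestrictLe n ρ} ×ˢ {ρ (n + 1)}) := by
    ext ρ'
    simp only [cyl, Set.mem_ofPred_eq, Set.mem_preimage, Set.mem_prod, Set.mem_singleton_iff,
      funext_iff, frestrictLe_apply, Subtype.forall, Finset.mem_Iic, Nat.le_succ_iff, or_imp,
      forall_and, forall_eq]
  rw [h, ← Measure.map_apply (by fun_prop) ((measurableSet_singleton _).prod
    (measurableSet_singleton _)), M.prob_eq, ← partialTraj_compProd_eq_map_traj (Nat.zero_le n),
    Measure.compProd_apply_prod (measurableSet_singleton _) (measurableSet_singleton _),
    lintegral_singleton, ← M.prob_eq, ← CMDP.prob_cyl]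
  congr 1
  exact PMF.toMeasure_apply_singleton _ _ (measurableSet_singleton _)

/-- A run all of whose cylinders have positive measure up to position `n` is compatible up to
that position. -/
lemma CMDP.of_prob_cyl_ne_zero {M : CMDP S A} {σ : Strategy S A} {s : S} {ρ : Run S A} {n : ℕ}
    (h : M.prob σ s (cyl ρ n) ≠ 0) :
    (ρ 0).state = s ∧ (∀ i ≤ n, (ρ i).act = σ (Run.pref ρ i)) ∧
      ∀ i < n, (ρ (i + 1)).state ∈ M.succ (ρ i).state (ρ i).act := by
  induction n with
  | zero =>
    obtain ⟨h₁, h₂⟩ := M.of_prob_cyl_zero_ne_zero σ s h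
    refine ⟨h₁, fun i hi => ?_, by simp⟩
    obtain rfl : i = 0 := by omega
    rw [h₂, Run.pref, h₁]
  | succ n ih =>
    rw [M.prob_cyl_succ] at h
    obtain ⟨h₁, h₂, h₃⟩ := ih (right_ne_zero_of_mul h)
    obtain ⟨h₄, h₅⟩ := M.of_stepPMF_ne_zero σ ρ n (left_ne_zero_of_mul h)
    refine ⟨h₁, fun i hi => ?_, fun i hi => ?_⟩
    · rcases Nat.le_succ_iff.1 hi with hi | rfl
      · exact h₂ i hi
      · exact h₄
    · rcases Nat.lt_succ_iff_lt_or_eq.1 hi with hi | rfl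
      · exact h₃ i hi
      · exact h₅

lemma finite_range_cyl (n : ℕ) : (Set.range fun ρ : Run S A => cyl ρ n).Finite := by
  have : (Set.range fun ρ : Run S A => cyl ρ n) ⊆
      Set.range fun x : (i : Finset.Iic n) → Step S A =>
        frestrictLe (π := fun _ : ℕ => Step S A) n ⁻¹' {x} := by
    rintro _ ⟨ρ, rfl⟩
    exact ⟨_, (cyl_eq_preimage ρ n).symm⟩
  exact (Set.finite_range _).subset this

/-- Almost every run is compatible. -/
lemma CMDP.ae_mem_compatible (M : CMDP S A) (σ : Strategy S A) (s : S) :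
    ∀ᵐ ρ ∂M.prob σ s, ρ ∈ M.compatible σ s := by
  have h : ∀ n, ∀ᵐ ρ ∂M.prob σ s, M.prob σ s (cyl ρ n) ≠ 0 := by
    intro n
    have hz : M.prob σ s (⋃₀ {C ∈ Set.range fun ρ : Run S A => cyl ρ n | M.prob σ s C = 0}) = 0 :=
      (measure_sUnion_null_iff ((finite_range_cyl n).subset (Set.sep_subset _ _)).countable).2
        fun C hC => hC.2
    refine measure_mono_null (fun ρ hρ => ?_) hz
    exact ⟨cyl ρ n, ⟨⟨ρ, rfl⟩, by simpa using hρ⟩, mem_cyl_self ρ n⟩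
  filter_upwards [ae_all_iff.2 h] with ρ hρ
  exact ⟨(CMDP.of_prob_cyl_ne_zero (hρ 0)).1, fun i =>
    ⟨(CMDP.of_prob_cyl_ne_zero (hρ i)).2.1 i le_rfl,
      (CMDP.of_prob_cyl_ne_zero (hρ (i + 1))).2.2 i i.lt_succ_self⟩⟩

/-- The positive transition probabilities have a positive lower bound. -/
lemma CMDP.exists_prob_bound (M : CMDP S A) :
    ∃ p : ℝ≥0∞, p ≠ 0 ∧ ∀ s a, ∀ t ∈ M.succ s a, p ≤ M.trans s a t := by
  cases nonempty_fintype S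
  cases nonempty_fintype A
  classical
  let D : Finset (S × A × S) := Finset.univ.filter fun x => x.2.2 ∈ M.succ x.1 x.2.1
  let g : S × A × S → ℝ≥0∞ := fun x => M.trans x.1 x.2.1 x.2.2
  refine ⟨min 1 (D.inf g), ?_, fun s a t ht => (min_le_right _ _).trans ?_⟩
  · refine (lt_min zero_lt_one ?_).ne'
    rw [Finset.lt_inf_iff (by simp)]
    intro x hx
    exact (Finset.mem_filter.1 hx).2
  · exact Finset.inf_le (f := g) (b := (s, a, t)) (Finset.mem_filter.2 ⟨Finset.mem_univ _, ht⟩)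

/-- Each further step along a compatible run costs at most a factor `p`, uniformly in the run. -/
lemma CMDP.mul_prob_cyl_le {M : CMDP S A} {p : ℝ≥0∞}
    (hp : ∀ s a, ∀ t ∈ M.succ s a, p ≤ M.trans s a t) {σ : Strategy S A} {s : S} {ρ : Run S A}
    (hρ : ρ ∈ M.compatible σ s) (n k : ℕ) :
    p ^ k * M.prob σ s (cyl ρ n) ≤ M.prob σ s (cyl ρ (n + k)) := by
  induction k with
  | zero => simp
  | succ k ih =>
    rw [← add_assoc, M.prob_cyl_succ, pow_succ', mul_assoc]
    refine mul_le_mul' ?_ ih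
    exact (hp _ _ _ (hρ.2 _).2).trans (M.stepPMF_apply_of_eq σ ρ _ (hρ.2 (n + k + 1)).1)

lemma CMDP.prob_cyl_pos {M : CMDP S A} {σ : Strategy S A} {s : S} {ρ : Run S A}
    (hρ : ρ ∈ M.compatible σ s) (n : ℕ) : 0 < M.prob σ s (cyl ρ n) := by
  obtain ⟨p, hp₀, hp⟩ := M.exists_prob_bound
  have h := CMDP.mul_prob_cyl_le hp hρ 0 n
  rw [M.prob_cyl_zero σ s hρ.1 (by rw [(hρ.2 0).1, Run.pref, hρ.1]), mul_one, zero_add] at h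
  exact lt_of_lt_of_le (pos_iff_ne_zero.2 (pow_ne_zero _ hp₀)) h

/-- A property that holds almost surely is satisfied by some compatible continuation of any
prefix of a compatible run. -/
lemma CMDP.exists_compatible_of_prob_eq_one {M : CMDP S A} {σ : Strategy S A} {s : S}
    {E : Set (Run S A)} (hE : M.prob σ s E = 1) {ρ : Run S A} (hρ : ρ ∈ M.compatible σ s)
    (n : ℕ) : ∃ ρ' ∈ M.compatible σ s, Run.pref ρ' n = Run.pref ρ n ∧ ρ' ∈ E := by
  by_contra! hcon
  have h₀ : M.prob σ s (cyl ρ n ∩ E) = 0 := by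
    refine measure_mono_null (fun ρ' hρ' => ?_) (ae_iff.1 (M.ae_mem_compatible σ s))
    intro hc
    refine hcon ρ' hc (Run.pref_congr (fun i hi => hρ'.1 i hi.le) ?_) hρ'.2
    rw [hρ'.1 n le_rfl]
  have h₁ : M.prob σ s (E ∪ cyl ρ n) ≤ 1 := prob_le_one
  -- Measurability of the cylinder suffices, so none is required of `E`.
  have h₂ := measure_union_add_inter E (μ := M.prob σ s) (measurableSet_cyl ρ n)
  rw [Set.inter_comm, h₀, hE, add_zero] at h₂
  have h₃ := M.prob_cyl_pos hρ n
  rw [h₂] at h₁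
  exact absurd (ENNReal.lt_add_right ENNReal.one_ne_top h₃.ne') (not_lt.2 h₁)

lemma CMDP.prob_reachRuns_pos {M : CMDP S A} {T : Set S} {σ : Strategy S A} {s : S}
    {ρ : Run S A} (hρ : ρ ∈ M.compatible σ s) {n : ℕ} (hn : (ρ n).state ∈ T) :
    0 < M.prob σ s (reachRuns T) :=
  (M.prob_cyl_pos hρ n).trans_le (measure_mono fun ρ' hρ' => ⟨n, by rwa [hρ' n le_rfl]⟩)

lemma measure_eq_sum_cyl (μ : Measure (Run S A)) (E : Set (Run S A)) (hE : MeasurableSet E)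
    (n : ℕ) : μ E = ∑ C ∈ (finite_range_cyl (S := S) (A := A) n).toFinset, μ (E ∩ C) := by
  rw [← measure_biUnion_finset]
  · congr 1
    ext ρ
    simp only [Set.Finite.mem_toFinset, Set.mem_iUnion, Set.mem_inter_iff, exists_prop]
    exact ⟨fun h => ⟨cyl ρ n, ⟨ρ, rfl⟩, h, mem_cyl_self ρ n⟩, fun ⟨_, _, h, _⟩ => h⟩
  · intro C hC D hD hne
    simp only [Set.Finite.coe_toFinset] at hC hD
    obtain ⟨ρ, rfl⟩ := hC
    obtain ⟨ρ', rfl⟩ := hD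
    rw [Function.onFun, Set.disjoint_left]
    rintro x ⟨_, hx⟩ ⟨_, hx'⟩
    refine hne ?_
    have : ∀ i ≤ n, ρ i = ρ' i := fun i hi => (hx i hi).symm.trans (hx' i hi)
    ext y
    exact ⟨fun h i hi => (h i hi).trans (this i hi), fun h i hi => (h i hi).trans (this i hi).symm⟩
  · intro C hC
    simp only [Set.Finite.mem_toFinset] at hC
    obtain ⟨ρ, rfl⟩ := hC
    exact hE.inter (measurableSet_cyl ρ n)

/-- If, whatever has happened so far, `T` can be visited within the next `N` steps, then almost
surely `T` is visited infinitely often. -/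
lemma CMDP.prob_buchiRuns_eq_one {M : CMDP S A} {T : Set S} {σ : Strategy S A} {s : S} (N : ℕ)
    (h : ∀ ρ ∈ M.compatible σ s, ∀ n, ∃ ρ' ∈ M.compatible σ s, Run.pref ρ' n = Run.pref ρ n ∧
      ∃ i, n < i ∧ i ≤ n + N ∧ (ρ' i).state ∈ T) :
    M.prob σ s (buchiRuns T) = 1 := by
  obtain ⟨p, hp₀, hp⟩ := M.exists_prob_bound
  set μ := M.prob σ s
  let B : ℕ → ℕ → Set (Run S A) := fun n m => {ρ | ∀ i, n < i → i ≤ m → (ρ i).state ∉ T}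
  let Bω : ℕ → Set (Run S A) := fun n => ⋂ m, B n m
  have hB : ∀ n m, MeasurableSet (B n m) := measurableSet_avoid T
  have hBω : ∀ n, MeasurableSet (Bω n) := fun n => .iInter (hB n)
  -- Inside each cylinder of length `m` with positive mass in `B n m`, some continuation visits `T`
  -- by time `m + N`. Its cylinder has at least the share `p ^ N` of the mass and is disjoint from
  -- `Bω n`.
  have hstep : ∀ n m, n ≤ m → μ (Bω n) + p ^ N * μ (B n m) ≤ μ (B n m) := by
    intro n m hnm
    rw [measure_eq_sum_cyl μ _ (hBω n) m, measure_eq_sum_cyl μ _ (hB n m) m, Finset.mul_sum,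
      ← Finset.sum_add_distrib]
    refine Finset.sum_le_sum fun C hC => ?_
    simp only [Set.Finite.mem_toFinset] at hC
    obtain ⟨ρ, rfl⟩ := hC
    have hsub : Bω n ∩ cyl ρ m ⊆ B n m ∩ cyl ρ m :=
      Set.inter_subset_inter_left _ (Set.iInter_subset _ m)
    by_cases h₀ : μ (B n m ∩ cyl ρ m) = 0
    · rw [measure_mono_null hsub h₀, h₀]; simp
    · obtain ⟨ρ₁, ⟨hρ₁B, hρ₁⟩, hc₁⟩ : ∃ ρ₁ ∈ B n m ∩ cyl ρ m, ρ₁ ∈ M.compatible σ s := by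
        by_contra! hcon
        exact h₀ (measure_mono_null hcon (ae_iff.1 (M.ae_mem_compatible σ s)))
      have hcyl : cyl ρ m = cyl ρ₁ m := by
        ext y
        exact ⟨fun h i hi => (h i hi).trans (hρ₁ i hi).symm, fun h i hi => (h i hi).trans (hρ₁ i hi)⟩
      change μ (Bω n ∩ cyl ρ m) + p ^ N * μ (B n m ∩ cyl ρ m) ≤ μ (B n m ∩ cyl ρ m)
      rw [hcyl]
      obtain ⟨ρ₂, hc₂, hpre, i, hi₁, hi₂, hiT⟩ := h ρ₁ hc₁ m
      have hagree : ∀ j ≤ m, ρ₂ j = ρ₁ j := fun j hj => CMDP.eq_of_pref_eq hc₂ hc₁ hpre hj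
      have hcyl₂ : cyl ρ₁ m = cyl ρ₂ m := by
        ext y
        exact ⟨fun h i hi => (h i hi).trans (hagree i hi).symm,
          fun h i hi => (h i hi).trans (hagree i hi)⟩
      rw [hcyl₂]
      have hsub₂ : cyl ρ₂ m ⊆ B n m := by
        intro y hy j hj₁ hj₂
        rw [hy j hj₂, hagree j hj₂]
        exact hρ₁B j hj₁ hj₂
      have hsub₃ : cyl ρ₂ (m + N) ⊆ cyl ρ₂ m := fun y hy j hj => hy j (by omega)
      rw [Set.inter_eq_right.2 hsub₂]
      calc μ (Bω n ∩ cyl ρ₂ m) + p ^ N * μ (cyl ρ₂ m)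
          ≤ μ (Bω n ∩ cyl ρ₂ m) + μ (cyl ρ₂ (m + N)) := by
            gcongr; exact CMDP.mul_prob_cyl_le hp hc₂ m N
        _ = μ ((Bω n ∩ cyl ρ₂ m) ∪ cyl ρ₂ (m + N)) := by
            rw [measure_union _ (measurableSet_cyl ρ₂ _)]
            rw [Set.disjoint_left]
            rintro y ⟨hy, -⟩ hy'
            have := Set.mem_iInter.1 hy i i (by omega) le_rfl
            rw [hy' i hi₂] at this
            exact this hiT
        _ ≤ μ (cyl ρ₂ m) := measure_mono (Set.union_subset Set.inter_subset_right hsub₃)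
  have hzero : ∀ n, μ (Bω n) = 0 := by
    intro n
    have hanti : Antitone (B n) := fun m m' hm y hy i h₁ h₂ => hy i h₁ (h₂.trans hm)
    have hinf : μ (Bω n) = ⨅ m, μ (B n m) :=
      hanti.measure_iInter (fun m => (hB n m).nullMeasurableSet) ⟨0, measure_ne_top _ _⟩
    -- Letting `m` grow in `hstep`; as the measure is finite and `p ^ N` is nonzero, this forces
    -- measure zero.
    have hle : μ (Bω n) + p ^ N * μ (Bω n) ≤ μ (Bω n) := by
      conv_rhs => rw [hinf]
      refine le_iInf fun m => ?_
      refine le_trans ?_ ((hstep n (max n m) (le_max_left _ _)).trans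
        (measure_mono (hanti (le_max_right _ _))))
      gcongr
      exact Set.iInter_subset _ _
    by_contra hne
    exact absurd (ENNReal.lt_add_right (measure_ne_top μ (Bω n))
      (mul_ne_zero (pow_ne_zero N hp₀) hne)) (not_lt.2 hle)
  have hae : ∀ᵐ ρ ∂μ, ρ ∈ buchiRuns T := by
    refine measure_mono_null (fun ρ hρ => ?_) (measure_iUnion_null hzero)
    have hfin : {i | (ρ i).state ∈ T}.Finite := not_not.1 hρ
    obtain ⟨n, hn⟩ := hfin.bddAbove
    exact Set.mem_iUnion.2 ⟨n, Set.mem_iInter.2 fun m i hi _ hT => by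
      have := hn hT; omega⟩
  exact (measure_congr (Filter.eventuallyEq_univ.2 hae)).trans measure_univ

end Probability

/-! ### The vector computed by the algorithm is a lower bound -/

/-- The computed vector is a lower bound for the levels from which a safe strategy may reach
`T`. -/
lemma CMDP.le_level_of_visit {M : CMDP S A} {T : Set S} {r : S → ℕ∞}
    (hT : ∀ s ∈ T, r s = M.safe s) (hr : M.nextVector T r = r) {σ : Strategy S A} {s : S} {d : ℕ}
    (h : M.IsSafe σ d s) (hd : d ≤ M.cap) {ρ : Run S A} (hρ : ρ ∈ M.compatible σ s) (k : ℕ) :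
    ∀ n m : ℕ, (ρ (n + k)).state ∈ T → M.level d (Run.pref ρ n) = m → r (ρ n).state ≤ m := by
  induction k with
  | zero =>
    intro n m hn hm
    rw [hT _ (by simpa using hn)]
    exact h.safe_le_level hd hρ hm
  | succ k ih =>
    intro n m hn hm
    by_cases hs : (ρ n).state ∈ T
    · rw [hT _ hs]
      exact h.safe_le_level hd hρ hm
    · obtain ⟨m', hm', hc⟩ := h.cost_add_level hρ hm
      rw [← hr, M.nextVector_le_iff r hs (M.level_le_cap hd _ _ hm)]
      exact ⟨(ρ n).act, m', hc, (ρ (n + 1)).state, (hρ.2 n).2,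
        ih (n + 1) m' (by rwa [add_right_comm]) hm',
        fun t ht _ => h.safe_succ_le_level hd hρ hm' ht⟩

/-! ### Policies that depend on the state and the level -/

lemma SelectionRule.exists_select {cap : ℕ} (φ : SelectionRule A cap) (a₀ : A) (m : ℕ)
    {n₀ : Fin (cap + 1)} (h₀ : φ n₀ ≠ none) (hm : (n₀ : ℕ) ≤ m) :
    ∃ n : Fin (cap + 1), φ n = some (φ.select a₀ m) ∧ (n : ℕ) ≤ m ∧
      ∀ n', φ n' ≠ none → (n' : ℕ) ≤ m → n' ≤ n := by
  classical
  unfold SelectionRule.select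
  set D : Finset (Fin (cap + 1)) :=
    Finset.univ.filter fun n => φ n ≠ none ∧ ((n : ℕ) : WithBot ℕ) ≤ m with hD
  have hmem : ∀ n, n ∈ D ↔ φ n ≠ none ∧ (n : ℕ) ≤ m := fun n => by
    simp only [hD, Finset.mem_filter, Finset.mem_univ, true_and, Nat.cast_le]
  have hne : D.Nonempty := ⟨n₀, (hmem _).2 ⟨h₀, hm⟩⟩
  have hmax := (hmem _).1 (D.max'_mem hne)
  refine ⟨D.max' hne, ?_, hmax.2, fun n' h₁ h₂ => D.le_max' _ ((hmem _).2 ⟨h₁, h₂⟩)⟩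
  simp only [dif_pos hne]
  obtain ⟨a, ha⟩ := Option.ne_none_iff_exists'.1 hmax.1
  rw [ha]; rfl

/-- Playing `f` from state `s` with level `m`, one may visit `T` after `k` steps. -/
inductive CMDP.MayVisit (M : CMDP S A) (T : Set S) (f : S → ℕ → A) : ℕ → S → ℕ → Prop
  | zero (s : S) (m : ℕ) (h : s ∈ T) : M.MayVisit T f 0 s m
  | succ (k : ℕ) (s : S) (m : ℕ) (t : S) (m' : ℕ) (ht : t ∈ M.succ s (f s m))
      (hc : M.cost s (f s m) + m' = M.avail s m) (h : M.MayVisit T f k t m') :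
      M.MayVisit T f (k + 1) s m

/-- A possible visit in the configuration graph becomes an actual compatible run extending any given
prefix that ends in that configuration. -/
lemma CMDP.MayVisit.exists_run {M : CMDP S A} {T : Set S} {f : S → ℕ → A} {k : ℕ} {q : S} {m : ℕ}
    (h : M.MayVisit T f k q m) {σ : Strategy S A} {s : S} {d : ℕ}
    (hσ : ∀ (h : History S A) (m : ℕ), h.first = s → M.level d h = m → σ h = f h.last m) :
    ∀ {ρ : Run S A} {n : ℕ}, ρ ∈ M.compatible σ s → (ρ n).state = q →
      M.level d (Run.pref ρ n) = m →
      ∃ ρ' ∈ M.compatible σ s, Run.pref ρ' n = Run.pref ρ n ∧ (ρ' (n + k)).state ∈ T := by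
  induction h with
  | zero q m hq => rintro ρ n hρ rfl _; exact ⟨ρ, hρ, rfl, hq⟩
  | succ k q m t m' ht hc _ ih =>
    rintro ρ n hρ rfl hm
    have ha : (ρ n).act = f (ρ n).state m := by
      rw [(hρ.2 n).1, hσ _ m (by rw [Run.pref_first, hρ.1]) hm, Run.pref_last]
    rw [← ha] at ht hc
    obtain ⟨ρ₁, hρ₁, hpre₁, hst₁⟩ := M.exists_compatible_step hρ n ht
    have hn : ρ₁ n = ρ n := M.eq_of_pref_eq hρ₁ hρ hpre₁ le_rfl
    obtain ⟨ρ₂, hρ₂, hpre₂, hT⟩ := ih hρ₁ hst₁ (by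
      rw [M.updateLevel_pref_succ, hpre₁, hn, hm, M.updateLevel_eq_coe_iff, hc])
    exact ⟨ρ₂, hρ₂, (Run.pref_eq_of_le hpre₂ n.le_succ).trans hpre₁, by
      rwa [← add_assoc, add_right_comm]⟩

/-- The policy of a counter selector. -/
def CMDP.policy (M : CMDP S A) (Sel : CounterSelector S A M.cap) (a₀ : A) (s : S) (m : ℕ) : A :=
  (Sel s).select a₀ m

/-- A rule is always present at `Safe(s)`, so the default action is never used at a safe level. The
selected rule sits at a level at most `m`, and what is safe there is safe at `m`. -/
lemma CMDP.LoopInvariant.policy_closed {M : CMDP S A} {T : Set S} {r : S → ℕ∞}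
    {Sel : CounterSelector S A M.cap} (h : M.LoopInvariant T r Sel) (a₀ : A) {s : S} {m : ℕ}
    (hm : m ≤ M.cap) (hs : M.safe s ≤ m) :
    ∃ m' : ℕ, M.cost s (M.policy Sel a₀ s m) + m' = M.avail s m ∧ m' ≤ M.cap ∧
      ∀ t ∈ M.succ s (M.policy Sel a₀ s m), M.safe t ≤ m' := by
  obtain ⟨d, hd⟩ := ENat.ne_top_iff_exists.1 (ne_top_of_le_ne_top (ENat.natCast_ne_top m) hs)
  have hdm : d ≤ m := by rw [← hd] at hs; exact_mod_cast hs
  obtain ⟨n, hn, hnm, -⟩ := (Sel s).exists_select a₀ m (n₀ := ⟨d, by omega⟩)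
    (h.ne_none_of_eq_safe s ⟨d, by omega⟩ hd) hdm
  obtain ⟨m', hm', ht⟩ := (h.staysSafe s n _ hn).mono (M.avail_mono s hnm)
  exact ⟨m', hm', by have := M.avail_le_cap s hm; omega, ht⟩

/-- The auxiliary `F` stands for a later selector. Later iterations write rules only strictly below
the current `r s`, so agreement from `r s` upwards is all that the induction over iterations can and
need assume. -/
lemma CMDP.PosReachLoop.exists_mayVisit {M : CMDP S A} {T : Set S} {r : S → ℕ∞}
    {Sel : CounterSelector S A M.cap} (h : M.PosReachLoop T r Sel) (a₀ : A)
    (F : CounterSelector S A M.cap) (hF : ∀ s (n : Fin (M.cap + 1)), r s ≤ (n : ℕ) →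
      F s n = Sel s n) {s : S} {m : ℕ} (hm : m ≤ M.cap) (hs : r s ≤ m) :
    ∃ k, M.MayVisit T (M.policy F a₀) k s m := by
  induction h generalizing s m with
  | start α hα =>
    by_cases hT : s ∈ T
    · exact ⟨0, .zero s m hT⟩
    · rw [CMDP.startVector, if_neg hT, top_le_iff] at hs
      exact absurd hs (ENat.natCast_ne_top m)
  | iterate r Sel α hl hα _ ih =>
    have inv := hl.loopInvariant
    replace ih : ∀ {s : S} {m : ℕ}, m ≤ M.cap → r s ≤ m →
        ∃ k, M.MayVisit T (M.policy F a₀) k s m := by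
      refine fun {s m} hm hs => ih (fun s n hn => ?_) hm hs
      rw [hF s n ((inv.nextVector_le s).trans hn), CMDP.nextSelector, if_neg]
      rintro ⟨-, h₁, h₂⟩
      exact absurd hn (not_le.2 (h₂ ▸ h₁))
    by_cases hrs : r s ≤ m
    · exact ih hm hrs
    have hT : s ∉ T := by
      intro hT
      exact hrs (((inv.eq_safe s hT).le.trans (M.safe_le_nextVector T inv.safe_le s)).trans hs)
    obtain ⟨d, hd⟩ := ENat.ne_top_iff_exists.1 (ne_top_of_le_ne_top (ENat.natCast_ne_top m) hs)
    have hdm : d ≤ m := by rw [← hd] at hs; exact_mod_cast hs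
    have hdr : M.nextVector T r s < r s := lt_of_le_of_lt hs (not_le.1 hrs)
    let n₀ : Fin (M.cap + 1) := ⟨d, by omega⟩
    have hn₀ : F s n₀ = some (α s) := by
      rw [hF s n₀ hd.ge, CMDP.nextSelector, if_pos ⟨hT, hdr, hd⟩]
    obtain ⟨n, hn, hnm, hmax⟩ := (F s).exists_select a₀ m (n₀ := n₀) (by simp [hn₀]) hdm
    have hle : n₀ ≤ n := hmax n₀ (by simp [hn₀]) hdm
    -- The other rules lie at `Safe(s)`, which is not above the new value, or at levels at least the
    -- old value, which exceeds `m`. So the rule just written is the one selected.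
    have hnn₀ : n = n₀ := by
      by_contra hne
      have hdn : d < n := lt_of_le_of_ne hle fun h => hne (Fin.ext h.symm)
      have hdn' : M.nextVector T r s < ((n : ℕ) : ℕ∞) := by rw [← hd]; exact_mod_cast hdn
      have hSel : F s n = Sel s n := by
        rw [hF s n hdn'.le, CMDP.nextSelector, if_neg]
        rintro ⟨-, -, h⟩
        exact hdn'.ne' h
      rcases inv.level_of_ne_none s n (by rw [← hSel, hn]; simp) with h | h
      · exact absurd (M.safe_le_nextVector T inv.safe_le s) (not_le.2 (h ▸ hdn'))
      · exact hrs (h.trans (by exact_mod_cast hnm))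
    have hα' : M.policy F a₀ s m = α s := by
      rw [hnn₀, hn₀] at hn
      exact (Option.some.inj hn).symm
    obtain ⟨m', hm', t, ht, hrt, -⟩ := (hα.nextVector_le_iff hT hm).1 hs
    obtain ⟨k, hk⟩ := ih (s := t) (m := m')
      (by have := M.avail_le_cap s hm; omega) hrt
    exact ⟨k + 1, .succ k s m t m' (by rwa [hα']) (by rwa [hα']) hk⟩

/-! ### Decreasing CMDPs -/

/-- In a decreasing CMDP the resource cannot be sufficient for an infinite path without
reloading. -/
lemma CMDP.IsDecreasing.not_forever [Finite S] {M : CMDP S A} (hM : M.IsDecreasing) (p : ℕ → S)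
    (a : ℕ → A) (m : ℕ → ℕ) (hp : ∀ i, p (i + 1) ∈ M.succ (p i) (a i))
    (hm : ∀ i, M.cost (p i) (a i) + m (i + 1) = m i) : False := by
  classical
  have hanti : Antitone m := antitone_nat_of_succ_le fun i => by have := hm i; omega
  -- From the minimizer `N` on, the nonincreasing level is constant, so all costs vanish.
  obtain ⟨N, hN⟩ : ∃ N, ∀ i, m N ≤ m i :=
    ⟨Function.argmin m, fun i => Function.argmin_le m i⟩
  have hcost : ∀ i, N ≤ i → M.cost (p i) (a i) = 0 := by
    intro i hi
    have h₁ := hN (i + 1)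
    have h₂ := hanti hi
    have h₃ := hm i
    omega
  have hex : ∃ L, 0 < L ∧ ∃ i, N ≤ i ∧ p (i + L) = p i := by
    obtain ⟨i, j, hij, h⟩ := Finite.exists_ne_map_eq_of_infinite fun i => p (N + i)
    rcases lt_or_gt_of_ne hij with hlt | hlt
    · exact ⟨j - i, by omega, N + i, by omega, by
        rw [show N + i + (j - i) = N + j by omega]; exact h.symm⟩
    · exact ⟨i - j, by omega, N + j, by omega, by
        rw [show N + j + (i - j) = N + i by omega]; exact h⟩
  obtain ⟨hL, i, hi, hpi⟩ := Nat.find_spec hex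
  have hmin : ∀ L', 0 < L' → (∃ i, N ≤ i ∧ p (i + L') = p i) → Nat.find hex ≤ L' :=
    fun L' h₁ h₂ => Nat.find_min' hex ⟨h₁, h₂⟩
  -- A state repetition of least length beyond `N` is a simple cycle, and it costs nothing.
  obtain ⟨j, -, hj⟩ := hM (Nat.find hex) (fun j => p (i + j)) (fun j => a (i + j)) hL
    (fun j _ => hp (i + j)) (by simpa using hpi) (by
      have key : ∀ u v, u < v → v < Nat.find hex → p (i + u) ≠ p (i + v) := by
        intro u v huv hv heq
        have := hmin (v - u) (by omega) ⟨i + u, by omega, by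
          rw [show i + u + (v - u) = i + v by omega, heq]⟩
        omega
      intro u hu v hv heq
      by_contra hne
      rcases lt_or_gt_of_ne hne with hlt | hlt
      · exact key u v hlt hv heq
      · exact key v u hlt hu heq.symm)
  rw [hcost (i + j) (by omega)] at hj
  exact absurd hj (lt_irrefl 0)

lemma CMDP.nextVector_le_zero_of_reload {M : CMDP S A} {T : Set S} {r : S → ℕ∞} {q : S}
    (hq : q ∈ M.reload) (h : M.nextVector T r q ≤ M.cap) : M.nextVector T r q ≤ (0 : ℕ) := by
  unfold CMDP.nextVector at h ⊢
  rw [M.trunc_le_iff _ _ le_rfl, M.avail_of_mem hq] at h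
  rwa [M.trunc_le_iff _ _ (Nat.zero_le _), M.avail_of_mem hq]

lemma CMDP.IsDecreasing.exists_mayVisit [Finite S] {M : CMDP S A} (hM : M.IsDecreasing)
    {T : Set S} {r : S → ℕ∞} {Sel : CounterSelector S A M.cap} (h : M.PosReachReturns T r Sel)
    (hR : ∀ q ∈ M.reload, r q ≤ M.cap) (a₀ : A) {s : S} {m : ℕ} (hm : m ≤ M.cap)
    (hs : M.safe s ≤ m) : ∃ k, M.MayVisit T (M.policy Sel a₀) k s m := by
  obtain ⟨hl, hfix⟩ := h.posReachLoop
  have inv := hl.loopInvariant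
  by_contra hcon
  let f := M.policy Sel a₀
  -- The safe configurations from which `T` cannot be visited. They are closed under all successors
  -- and contain no reload state, because there `r` is at most `0` and hence at most the level.
  let Q : S × ℕ → Prop := fun c => c.2 ≤ M.cap ∧ M.safe c.1 ≤ c.2 ∧
    ¬∃ k, M.MayVisit T f k c.1 c.2
  have hstep : ∀ c : {c // Q c}, ∃ c' : {c // Q c},
      c'.1.1 ∈ M.succ c.1.1 (f c.1.1 c.1.2) ∧
      M.cost c.1.1 (f c.1.1 c.1.2) + c'.1.2 = c.1.2 := by
    rintro ⟨⟨q, m⟩, hm, hs, hno⟩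
    obtain ⟨m', hm', hcap, ht⟩ := inv.policy_closed a₀ hm hs
    have hlt : ¬r q ≤ m := fun hle => hno (hl.exists_mayVisit a₀ Sel (fun _ _ _ => rfl) hm hle)
    have hq : q ∉ M.reload := by
      intro hq
      refine hlt ?_
      have := hR q hq
      rw [← hfix] at this ⊢
      exact (M.nextVector_le_zero_of_reload hq this).trans (by exact_mod_cast Nat.zero_le m)
    obtain ⟨t, htm⟩ := M.succ_nonempty q (f q m)
    refine ⟨⟨(t, m'), hcap, ht t htm, ?_⟩, htm, ?_⟩
    · rintro ⟨k, hk⟩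
      exact hno ⟨k + 1, .succ k q m t m' htm hm' hk⟩
    · rw [M.avail_of_notMem hq] at hm'; exact hm'
  choose g hg using hstep
  let c : ℕ → {c // Q c} := fun n => g^[n] ⟨(s, m), hm, hs, hcon⟩
  have hc : ∀ i, c (i + 1) = g (c i) := fun i => Function.iterate_succ_apply' g i _
  exact hM.not_forever (fun i => (c i).1.1) (fun i => f (c i).1.1 (c i).1.2) (fun i => (c i).1.2)
    (fun i => by simp only [hc]; exact (hg (c i)).1) (fun i => by simp only [hc]; exact (hg (c i)).2)

/-! ### Counter strategies -/

lemma CMDP.counterStrategy_eq_policy (M : CMDP S A) (Sel : CounterSelector S A M.cap)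
    {r : S → ℕ∞} (a₀ : A) {s : S} {d : ℕ} (hd : d ≤ M.cap) (hs : r s = d) (h : History S A)
    (m : ℕ) (hf : h.first = s) (hm : M.level d h = m) :
    M.counterStrategy Sel r a₀ h = M.policy Sel a₀ h.last m := by
  have : initialCounter M.cap (r h.first) = (d : WithBot ℕ) := by
    rw [hf, hs, initialCounter, if_pos (by exact_mod_cast hd), ENat.toNat_natCast]
  rw [CMDP.counterStrategy, this, hm, CMDP.policy]

lemma CMDP.PosReachReturns.exists_level {M : CMDP S A} {T : Set S} {r : S → ℕ∞}
    {Sel : CounterSelector S A M.cap} (h : M.PosReachReturns T r Sel) (a₀ : A) {s : S} {d : ℕ}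
    (hd : d ≤ M.cap) (hs : r s = d) {ρ : Run S A}
    (hρ : ρ ∈ M.compatible (M.counterStrategy Sel r a₀) s) (n : ℕ) :
    ∃ m : ℕ, M.level d (Run.pref ρ n) = m ∧ m ≤ M.cap ∧ M.safe (ρ n).state ≤ m := by
  have inv := h.posReachLoop.1.loopInvariant
  obtain ⟨m, hm, -, hI⟩ := M.exists_level_of_invariant (M.policy Sel a₀)
    (fun t m => m ≤ M.cap ∧ M.safe t ≤ m) (M.counterStrategy_eq_policy Sel a₀ hd hs)
    (fun t m ⟨hm, ht⟩ => by
      obtain ⟨m', hm', hcap, hsucc⟩ := inv.policy_closed a₀ hm ht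
      exact ⟨m', (M.updateLevel_eq_coe_iff _ _ _ _).2 hm', fun u hu => ⟨hcap, hsucc u hu⟩⟩)
    ⟨hd, hs ▸ inv.safe_le s⟩ hρ n
  exact ⟨m, hm, hI⟩

lemma CMDP.PosReachReturns.isSafe {M : CMDP S A} {T : Set S} {r : S → ℕ∞}
    {Sel : CounterSelector S A M.cap} (h : M.PosReachReturns T r Sel) (a₀ : A) {s : S} {d : ℕ}
    (hd : d ≤ M.cap) (hs : r s = d) : M.IsSafe (M.counterStrategy Sel r a₀) d s := by
  intro ρ hρ n
  obtain ⟨m, hm, -⟩ := h.exists_level a₀ hd hs hρ n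
  rw [hm]; exact WithBot.coe_ne_bot

lemma CMDP.PosReachReturns.le_cap {M : CMDP S A} {T : Set S} {r : S → ℕ∞}
    {Sel : CounterSelector S A M.cap} (h : M.PosReachReturns T r Sel) {s : S} {d : ℕ}
    (hs : r s = d) : d ≤ M.cap := by
  rcases h.posReachLoop.1.loopInvariant.truncated s with h' | ⟨n, hn, h'⟩
  · rw [hs] at h'; exact absurd h' (ENat.natCast_ne_top d)
  · rw [hs] at h'
    obtain rfl : d = n := by exact_mod_cast h'
    exact hn

/-! ### Changing the set of reload states -/

/-- Along each run the level in `M` dominates the level in `M(R')`, since a reload fills up to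
`cap`. -/
lemma CMDP.IsSafe.of_withReload {M : CMDP S A} {R' : Set S} (hR : R' ⊆ M.reload)
    {σ : Strategy S A} {s : S} {d : ℕ} (hd : d ≤ M.cap) (h : (M.withReload R').IsSafe σ d s) :
    M.IsSafe σ d s := by
  have key : ∀ ρ ∈ M.compatible σ s, ∀ n, ∃ m m' : ℕ, m ≤ m' ∧
      (M.withReload R').level d (Run.pref ρ n) = m ∧ M.level d (Run.pref ρ n) = m' := by
    intro ρ hρ n
    induction n with
    | zero => exact ⟨d, d, le_rfl, rfl, rfl⟩
    | succ n ih =>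
      obtain ⟨m, m', hle, hm, hm'⟩ := ih
      obtain ⟨k, hk, hc⟩ := h.cost_add_level hρ hm
      have hcap : m ≤ M.cap := CMDP.level_le_cap (M := M.withReload R') hd _ _ hm
      have hav : (M.withReload R').avail (ρ n).state m ≤ M.avail (ρ n).state m' := by
        by_cases hq : (ρ n).state ∈ R'
        · rw [M.avail_of_mem (hR hq), CMDP.avail_of_mem (M := M.withReload R') hq]; rfl
        · rw [CMDP.avail_of_notMem (M := M.withReload R') hq]
          exact (M.le_avail _ hcap).trans (M.avail_mono _ hle)
      have hcost : (M.withReload R').cost (ρ n).state (ρ n).act =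
          M.cost (ρ n).state (ρ n).act := rfl
      refine ⟨k, M.avail (ρ n).state m' - M.cost (ρ n).state (ρ n).act, by omega, hk, ?_⟩
      rw [M.updateLevel_pref_succ, hm', M.updateLevel_eq_coe_iff]
      omega
  intro ρ hρ n
  obtain ⟨_, m', -, -, hm'⟩ := key ρ hρ n
  rw [hm']; exact WithBot.coe_ne_bot

lemma CMDP.updateLevel_withReload (M : CMDP S A) {Rel : Set S} (m : WithBot ℕ) {s : S} (a : A)
    (h : s ∈ M.reload ↔ s ∈ Rel) : (M.withReload Rel).updateLevel m s a = M.updateLevel m s a := by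
  obtain rfl | ⟨m, rfl⟩ := eq_bot_or_exists_eq_natCast m
  · rfl
  · have : (M.withReload Rel).avail s m = M.avail s m := by
      by_cases hs : s ∈ Rel
      · rw [M.avail_of_mem (h.2 hs), CMDP.avail_of_mem (M := M.withReload Rel) hs]; rfl
      · rw [M.avail_of_notMem (fun h' => hs (h.1 h')),
          CMDP.avail_of_notMem (M := M.withReload Rel) hs]
    rw [CMDP.updateLevel_coe, CMDP.updateLevel_coe, this]; rfl

lemma CMDP.level_withReload {M : CMDP S A} {Rel : Set S} (d : WithBot ℕ) {ρ : Run S A}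
    (h : ∀ n, (ρ n).state ∈ M.reload ↔ (ρ n).state ∈ Rel) (n : ℕ) :
    (M.withReload Rel).level d (Run.pref ρ n) = M.level d (Run.pref ρ n) := by
  induction n with
  | zero => rfl
  | succ n ih =>
    rw [CMDP.updateLevel_pref_succ, CMDP.updateLevel_pref_succ, ih,
      M.updateLevel_withReload _ _ (h n)]

/-! ### Safe positive reachability and Büchi objectives -/

variable [Finite S] [Finite A]

lemma CMDP.PosReachReturns.isPosSafe {M : CMDP S A} {T : Set S} {r : S → ℕ∞}
    {Sel : CounterSelector S A M.cap} (h : M.PosReachReturns T r Sel) (a₀ : A) {s : S} {d : ℕ}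
    (hs : r s = d) : M.IsPosSafe T (M.counterStrategy Sel r a₀) d s := by
  have hd := h.le_cap hs
  refine ⟨h.isSafe a₀ hd hs, ?_⟩
  obtain ⟨k, hk⟩ := h.posReachLoop.1.exists_mayVisit a₀ Sel (fun _ _ _ => rfl) hd hs.le
  obtain ⟨ρ, hρ⟩ := M.compatible_nonempty (M.counterStrategy Sel r a₀) s
  obtain ⟨ρ', hρ', -, hT⟩ := hk.exists_run (M.counterStrategy_eq_policy Sel a₀ hd hs)
    (n := 0) hρ hρ.1 rfl
  exact M.prob_reachRuns_pos hρ' hT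

lemma CMDP.PosReachReturns.safePosReach_le [Nonempty A] {M : CMDP S A} {T : Set S} {r : S → ℕ∞}
    {Sel : CounterSelector S A M.cap} (h : M.PosReachReturns T r Sel) (s : S) :
    M.safePosReach T s ≤ r s := by
  rcases h.posReachLoop.1.loopInvariant.truncated s with h' | ⟨n, hn, h'⟩
  · rw [h']; exact le_top
  · rw [h']
    exact M.minLoad_le hn (h.isPosSafe (Classical.arbitrary A) h')

lemma CMDP.PosReachReturns.le_of_isPosSafe {M : CMDP S A} {T : Set S} {r : S → ℕ∞}
    {Sel : CounterSelector S A M.cap} (h : M.PosReachReturns T r Sel) {σ : Strategy S A} {s : S}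
    {d : ℕ} (hd : d ≤ M.cap) (hσ : M.IsPosSafe T σ d s) : r s ≤ d := by
  obtain ⟨hl, hfix⟩ := h.posReachLoop
  obtain ⟨ρ, ⟨k, hk⟩, hρ⟩ : ∃ ρ ∈ reachRuns T, ρ ∈ M.compatible σ s := by
    by_contra! hcon
    exact hσ.2.ne' (MeasureTheory.measure_mono_null hcon
      (MeasureTheory.ae_iff.1 (M.ae_mem_compatible σ s)))
  have := M.le_level_of_visit hl.loopInvariant.eq_safe hfix hσ.1 hd hρ k 0 d (by rwa [zero_add]) rfl
  rwa [hρ.1] at this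

lemma CMDP.IsDecreasing.isBuchiSafe {M : CMDP S A} (hM : M.IsDecreasing)
    {T : Set S} {r : S → ℕ∞} {Sel : CounterSelector S A M.cap} (h : M.PosReachReturns T r Sel)
    (hR : ∀ q ∈ M.reload, r q ≤ M.cap) (a₀ : A) {s : S} {d : ℕ} (hs : r s = d) :
    M.IsBuchiSafe T (M.counterStrategy Sel r a₀) d s := by
  have hd := h.le_cap hs
  refine ⟨h.isSafe a₀ hd hs, ?_⟩
  cases nonempty_fintype S
  have hk : ∀ c : S × Fin (M.cap + 1), ∃ k, M.safe c.1 ≤ (c.2 : ℕ) →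
      M.MayVisit T (M.policy Sel a₀) k c.1 c.2 := by
    intro c
    by_cases hc : M.safe c.1 ≤ (c.2 : ℕ)
    · obtain ⟨k, hk⟩ := hM.exists_mayVisit h hR a₀ (Nat.lt_succ_iff.1 c.2.2) hc
      exact ⟨k, fun _ => hk⟩
    · exact ⟨0, fun h => absurd h hc⟩
  choose K hK using hk
  -- The visit must come strictly after `n`, so the search starts at position `n + 1`; this accounts
  -- for the summand `1`.
  refine M.prob_buchiRuns_eq_one (1 + Finset.univ.sup K) fun ρ hρ n => ?_
  obtain ⟨m, hm, hcap, hsafe⟩ := h.exists_level a₀ hd hs hρ (n + 1)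
  let c : S × Fin (M.cap + 1) := ((ρ (n + 1)).state, ⟨m, by omega⟩)
  obtain ⟨ρ', hρ', hpre, hT⟩ := (hK c hsafe).exists_run
    (M.counterStrategy_eq_policy Sel a₀ hd hs) hρ rfl hm
  have : K c ≤ Finset.univ.sup K := Finset.le_sup (Finset.mem_univ c)
  exact ⟨ρ', hρ', Run.pref_eq_of_le hpre n.le_succ, n + 1 + K c, by omega, by omega, hT⟩

/-! ### The algorithm computing the reload set -/

lemma CMDP.BuchiLoop.subset {M : CMDP S A} {T Rel : Set S} (h : M.BuchiLoop T Rel) :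
    Rel ⊆ M.reload := by
  induction h with
  | start => exact subset_rfl
  | iterate Rel _ ih => exact Set.sdiff_subset.trans ih

lemma CMDP.exists_buchiTerminates (M : CMDP S A) (T : Set S) : ∃ R', M.BuchiTerminates T R' := by
  have key : ∀ Rel, M.BuchiLoop T Rel → ∃ R', M.BuchiTerminates T R' := by
    intro Rel
    induction Rel using WellFoundedLT.induction with
    | ind Rel ih =>
      intro h
      by_cases hne : M.toRemove T Rel = ∅
      · exact ⟨Rel, h, hne⟩
      · refine ih _ ?_ (.iterate Rel h)
        obtain ⟨q, hq⟩ := Set.nonempty_iff_ne_empty.2 hne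
        exact ⟨Set.sdiff_subset, fun h' => (h' hq.1).2 hq⟩
  exact key _ .start

/-- The reload states visited by a Büchi-safe strategy are never removed. -/
lemma CMDP.BuchiLoop.mem_of_isBuchiSafe [Nonempty A] {M : CMDP S A} {T Rel : Set S}
    (h : M.BuchiLoop T Rel) {σ : Strategy S A} {s : S} {d : ℕ} (hd : d ≤ M.cap)
    (hσ : M.IsBuchiSafe T σ d s) {ρ : Run S A} (hρ : ρ ∈ M.compatible σ s) (n : ℕ)
    (hn : (ρ n).state ∈ M.reload) : (ρ n).state ∈ Rel := by
  induction h generalizing ρ n with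
  | start => exact hn
  | iterate Rel hl ih =>
    have hiff : ∀ ρ ∈ M.compatible σ s, ∀ n, (ρ n).state ∈ M.reload ↔ (ρ n).state ∈ Rel :=
      fun ρ hρ n => ⟨ih hρ n, fun h => hl.subset h⟩
    have hsafe : (M.withReload Rel).IsSafe σ d s := by
      intro ρ hρ n
      rw [CMDP.level_withReload d (hiff ρ hρ)]
      exact hσ.1 hρ n
    -- Some continuation returns to `T`, so the lower bound applies at position `n` in `M(Rel)`,
    -- where `σ` is still safe. The computed value there is at most the current level, hence at most
    -- `cap`.
    obtain ⟨ρ', hρ', hpre, hinf⟩ := M.exists_compatible_of_prob_eq_one hσ.2 hρ n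
    obtain ⟨j, hjT, hj⟩ := Set.Infinite.exists_gt hinf n
    obtain ⟨r, Sel, hr⟩ := (M.withReload Rel).exists_posReachReturns T
    obtain ⟨hloop, hfix⟩ := hr.posReachLoop
    obtain ⟨m, hm⟩ := hsafe.exists_level hρ' n
    have hle := CMDP.le_level_of_visit hloop.loopInvariant.eq_safe hfix hsafe hd hρ' (j - n) n m
      (by rw [Nat.add_sub_cancel' hj.le]; exact hjT) hm
    rw [Run.state_eq_of_pref_eq hpre le_rfl] at hle
    have hcap : m ≤ M.cap := CMDP.level_le_cap (M := M.withReload Rel) hd _ _ hm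
    refine ⟨ih hρ n hn, fun hrem => ?_⟩
    refine absurd hrem.2 (not_lt.2 ?_)
    exact (hr.safePosReach_le _).trans (hle.trans (by exact_mod_cast hcap))

lemma CMDP.IsBuchiSafe.withReload [Nonempty A] {M : CMDP S A} {T R' : Set S}
    (h : M.BuchiLoop T R') {σ : Strategy S A} {s : S} {d : ℕ} (hd : d ≤ M.cap)
    (hσ : M.IsBuchiSafe T σ d s) : (M.withReload R').IsBuchiSafe T σ d s := by
  -- The measure on runs does not depend on the reload set; only the levels have to be compared.
  refine ⟨fun ρ hρ n => ?_, hσ.2⟩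
  rw [CMDP.level_withReload d fun n => ⟨h.mem_of_isBuchiSafe hd hσ hρ n, fun h' => h.subset h'⟩]
  exact hσ.1 hρ n

lemma CMDP.IsBuchiSafe.isPosSafe {M : CMDP S A} {T : Set S} {σ : Strategy S A} {s : S} {d : ℕ}
    (h : M.IsBuchiSafe T σ d s) : M.IsPosSafe T σ d s := by
  refine ⟨h.1, zero_lt_one.trans_le (h.2.ge.trans (MeasureTheory.measure_mono ?_))⟩
  intro ρ hρ
  exact Set.Infinite.nonempty hρ

end ConsumptionMDP

end

/-! ### Correctness of the two algorithms. -/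

theorem mainTheorem2 {S A : Type*} [Finite S] [Finite A] [Nonempty A]
    (M : ConsumptionMDP.CMDP S A) (hM : M.IsDecreasing) (T : Set S) :
    (∃ R' : Set S, M.BuchiTerminates T R') ∧
    ∀ R' : Set S, M.BuchiTerminates T R' →
      (∃ r Sel, (M.withReload R').PosReachReturns T r Sel) ∧
      ∀ (r : S → ℕ∞) (Sel : ConsumptionMDP.CounterSelector S A (M.withReload R').cap),
        (M.withReload R').PosReachReturns T r Sel →
        (∀ (a₀ : A) (s : S) (d : ℕ), r s = d → d ≤ M.cap ∧
          (M.withReload R').IsBuchiSafe T ((M.withReload R').counterStrategy Sel r a₀) d s ∧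
          M.IsBuchiSafe T ((M.withReload R').counterStrategy Sel r a₀) d s) ∧
        r = M.safeBuchi T := by
  open ConsumptionMDP in
  refine ⟨M.exists_buchiTerminates T, fun R' hR' =>
    ⟨(M.withReload R').exists_posReachReturns T, fun r Sel h => ?_⟩⟩
  have hsub := hR'.1.subset
  -- Nothing is left to remove, so each remaining reload state has a positively safe strategy, whose
  -- load bounds `r`.
  have hR : ∀ q ∈ R', r q ≤ M.cap := by
    intro q hq
    have hle : (M.withReload R').safePosReach T q ≤ M.cap := by
      by_contra hcon
      exact Set.notMem_empty q (hR'.2 ▸ ⟨hq, not_le.1 hcon⟩)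
    obtain ⟨d, hd, ⟨σ, hσ⟩, -⟩ := CMDP.exists_of_minLoad_ne_top
      (ne_top_of_le_ne_top (ENat.natCast_ne_top _) hle)
    exact (h.le_of_isPosSafe hd hσ).trans (by exact_mod_cast hd)
  have hdec : (M.withReload R').IsDecreasing := hM
  have main : ∀ (a₀ : A) (s : S) (d : ℕ), r s = d → d ≤ M.cap ∧
      (M.withReload R').IsBuchiSafe T ((M.withReload R').counterStrategy Sel r a₀) d s ∧
      M.IsBuchiSafe T ((M.withReload R').counterStrategy Sel r a₀) d s := by
    intro a₀ s d hs
    have hd : d ≤ M.cap := h.le_cap hs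
    have hb := hdec.isBuchiSafe h hR a₀ hs
    exact ⟨hd, hb, hb.1.of_withReload hsub hd, hb.2⟩
  refine ⟨main, funext fun s => le_antisymm ?_ ?_⟩
  · by_cases htop : M.safeBuchi T s = ⊤
    · rw [htop]; exact le_top
    · obtain ⟨d, hd, ⟨σ, hσ⟩, hd'⟩ := CMDP.exists_of_minLoad_ne_top htop
      rw [CMDP.safeBuchi, hd']
      exact h.le_of_isPosSafe hd (hσ.withReload hR'.1 hd).isPosSafe
  · by_cases htop : r s = ⊤
    · rw [htop]; exact le_top
    · obtain ⟨d, hd⟩ := ENat.ne_top_iff_exists.1 htop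
      rw [← hd]
      obtain ⟨hcap, -, hb⟩ := main (Classical.arbitrary A) s d hd.symm
      exact CMDP.minLoad_le hcap hb
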